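/- Let $X_1=\{X_1(t)\}_{t\in[0,1]}$ and $X_2=\{X_2(t)\}_{t\in[0,1]}$ be two independent continuous centered Gaussian processes on a probability space, both starting at $0$, with covariance functions $R_1,R_2$. Let $\mathcal E$ be the space of step functions $\sum_k a_k\mathbf 1_{(t_k,t_{k+1}]}$ on $[0,1]$ and let $H_i$ be the completion of $\mathcal E$ (functions at distance zero being identified) under $$\langle\varphi,\psi\rangle_{H_i}=\iint_{[0,1]^2}\varphi(s)\psi(t)\,dR_i(s,t),\qquad \iint \mathbf 1_{(0,u]}(s)\mathbf 1_{(0,v]}(t)\,dR_i(s,t)=R_i(u,v).$$ Put $H=H_1\oplus H_2$, and let $X:H\to L^2(P)$ be the isonormal Gaussian process with $X(h_1,h_2)=X_1(h_1)+X_2(h_2)$, where $X_i(\mathbf 1_{(a,b]})=X_i(b)-X_i(a)$. Let $I_2$ be the double Wiener–Itô integral on the Hilbert tensor square $H^{\otimes2}$: the continuous linear map with $I_2(g\otimes h)=X(g)X(h)-\langle g,h\rangle_H$. The Lévy kernel is $f^{\mathcal L}_{11}=f^{\mathcal L}_{22}=0$, $f^{\mathcal L}_{12}(s,t)=\tfrac12(\mathbf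 1_{s<t}-\mathbf 1_{s>t})$, $f^{\mathcal L}_{21}=-f^{\mathcal L}_{12}$. Assume that the generalised Lévy area exists, i.e. that there is a symmetric element $\hat f\in H^{\odot2}$ such that for every step function $g=(g_{ij})_{i,j=1,2}$, $g_{ij}\in\mathcal E\otimes\mathcal E$, $$\langle\hat f,g\rangle_{H^{\otimes2}}=\sum_{i,j=1}^2\iint_{[0,1]^2}\Bigl(\iint_{[0,1]^2}f^{\mathcal L}_{ij}(s,u)\,g_{ij}(t,v)\,dR_i(s,t)\Bigr)dR_j(u,v),$$ the integrals being Riemann–Stieltjes integrals (limits of Riemann–Stieltjes sums over tagged grids as the meshes tend to $0$). Let $A=I_2(\hat f)$ be the generalised Lévy area and let $F:H\to H$ be the operator with $\langle Fg,h\rangle_H=\langle\hat f,g\otimes h\rangle_{H^{\otimes2}}$ for all $g,h\in H$. Suppose that $R_1$ and $R_2$ are equivalent, i.e. they induce the same Hilbert space: the identity of $\mathcal E$ extends to a unitary map $H_1\to H_2$. Then: 1. $F$ is a Hilbert–Schmidt operator; its spectrum is symmetric about $0$, and $\alpha$ and $-\alpha$ have the same multiplicity for every $\alpha\in\mathbb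 R$. 2. Every eigenvalue of $F$ has even multiplicity (finite for a nonzero eigenvalue; if $0$ is an eigenvalue, its multiplicity is even or infinite). 3. Let $(\alpha_n)$ be the distinct positive eigenvalues of $F$ (finitely or countably many, possibly none), and let $2m_n$ be the multiplicity of $\alpha_n$. Then $m_n\ge1$ and, for all $t\in\mathbb R$, $$\varphi(t)=\mathbb E\bigl[e^{itA}\bigr]=\prod_n\frac{1}{(1+4\alpha_n^2t^2)^{m_n}},$$ where the product converges unconditionally (an empty product is $1$). -/

import Mathlib

open MeasureTheory ProbabilityTheory TensorProduct InnerProductSpace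
open scoped unitInterval

noncomputable section

namespace LevyArea

/-! ### Step functions on `[0,1]` and integration against their increments -/

/-- The indicator function of `(a, b] ⊆ [0,1]`. -/
def indIoc (a b : I) : I → ℝ := (Set.Ioc a b).indicator 1

/-- The step functions `∑ i, a i • 1_{(t i, t (i+1)]}` on `[0,1]`. -/
def stepFunctions : Submodule ℝ (I → ℝ) :=
  Submodule.span ℝ {f | ∃ a b : I, a ≤ b ∧ f = indIoc a b}

theorem indIoc_mem (a b : I) (h : a ≤ b) : indIoc a b ∈ stepFunctions :=
  Submodule.subset_span ⟨a, b, h, rfl⟩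

theorem indIoc_eq_sub (a b : I) (h : a ≤ b) : indIoc a b = indIoc 0 b - indIoc 0 a := by
  funext x
  have h0 : (0 : I) ≤ x := x.2.1
  have ha : (0 : I) ≤ a := a.2.1
  simp only [indIoc, Pi.sub_apply, Set.indicator_apply, Set.mem_Ioc, Pi.one_apply]
  by_cases hxa : x ≤ a
  · have hxb : x ≤ b := hxa.trans h
    simp [hxa, hxb, not_lt.mpr hxa]
  · have hx0 : 0 < x := ha.trans_lt (not_le.mp hxa)
    simp [hxa, hx0, not_le.mp hxa]

theorem linearIndependent_indIoc :
    LinearIndependent ℝ (fun t : Set.Ioi (0 : I) => indIoc 0 t) := by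
  classical
  rw [linearIndependent_iff']
  intro s c hc
  by_contra! hne
  obtain ⟨i, his, hci⟩ := hne
  have hfil : (s.filter (fun j => c j ≠ 0)).Nonempty := ⟨i, by simp [his, hci]⟩
  obtain ⟨m, hm, hmax⟩ := Finset.exists_max_image _ (fun j : Set.Ioi (0 : I) => j) hfil
  rw [Finset.mem_filter] at hm
  have hval := congrFun hc (m : I)
  rw [Finset.sum_apply, Finset.sum_eq_single m] at hval
  · have hm0 : (0 : I) < m := m.2
    simp [indIoc, hm0] at hval
    exact hm.2 hval
  · intro j hj hjm
    by_cases hcj : c j = 0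
    · simp [hcj]
    · have hle : j ≤ m := hmax j (by simp [hj, hcj])
      have hlt : j < m := lt_of_le_of_ne hle hjm
      have : ¬ ((m : I) ≤ j) := not_le.mpr hlt
      simp [indIoc, this]
  · intro h
    exact absurd hm.1 h

theorem span_indIoc :
    Submodule.span ℝ (Set.range (fun t : Set.Ioi (0 : I) => indIoc 0 t)) = stepFunctions := by
  have key : ∀ t : I,
      indIoc 0 t ∈ Submodule.span ℝ (Set.range (fun t : Set.Ioi (0 : I) => indIoc 0 t)) := by
    intro t
    rcases eq_or_lt_of_le (show (0 : I) ≤ t from t.2.1) with h | h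
    · have : indIoc 0 t = 0 := by rw [← h]; funext x; simp [indIoc]
      rw [this]
      exact Submodule.zero_mem _
    · exact Submodule.subset_span ⟨⟨t, h⟩, rfl⟩
  apply le_antisymm
  · rw [Submodule.span_le]
    rintro _ ⟨t, rfl⟩
    exact indIoc_mem _ _ (le_of_lt t.2)
  · rw [stepFunctions, Submodule.span_le]
    rintro _ ⟨a, b, hab, rfl⟩
    rw [indIoc_eq_sub a b hab]
    exact Submodule.sub_mem _ (key b) (key a)

/-- The functions `1_{(0,t]}`, `0 < t ≤ 1`, form a basis of the space of step functions. -/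
def stepBasis : Module.Basis (Set.Ioi (0 : I)) ℝ stepFunctions :=
  (Module.Basis.span linearIndependent_indIoc).map (LinearEquiv.ofEq _ _ span_indIoc)

theorem coe_stepBasis (t : Set.Ioi (0 : I)) : (stepBasis t : I → ℝ) = indIoc 0 t := by
  simp [stepBasis, Module.Basis.span_apply]

/-- The integral `∫ φ dF` of a step function against a function `F` on `[0,1]` with values in a
vector space: the linear map in `φ` with `∫ 1_{(a,b]} dF = F b - F a`
(see `stepIntegral_indIoc`). -/
def stepIntegral {M : Type*} [AddCommGroup M] [Module ℝ M] (F : I → M) :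
    stepFunctions →ₗ[ℝ] M :=
  stepBasis.constr ℝ (fun t => F t - F 0)

theorem stepIntegral_indIoc_zero {M : Type*} [AddCommGroup M] [Module ℝ M] (F : I → M) (t : I) :
    stepIntegral F ⟨indIoc 0 t, indIoc_mem 0 t t.2.1⟩ = F t - F 0 := by
  rcases eq_or_lt_of_le (show (0 : I) ≤ t from t.2.1) with h | h
  · subst h
    have : (⟨indIoc 0 0, indIoc_mem 0 0 le_rfl⟩ : stepFunctions) = 0 := by
      ext x; simp [indIoc]
    rw [this]; simp
  · have : (⟨indIoc 0 t, indIoc_mem 0 t t.2.1⟩ : stepFunctions) = stepBasis ⟨t, h⟩ :=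
      Subtype.ext (coe_stepBasis ⟨t, h⟩).symm
    rw [this, stepIntegral, Module.Basis.constr_basis]

theorem stepIntegral_indIoc {M : Type*} [AddCommGroup M] [Module ℝ M] (F : I → M) (a b : I)
    (h : a ≤ b) : stepIntegral F ⟨indIoc a b, indIoc_mem a b h⟩ = F b - F a := by
  have : (⟨indIoc a b, indIoc_mem a b h⟩ : stepFunctions)
      = ⟨indIoc 0 b, indIoc_mem 0 b b.2.1⟩ - ⟨indIoc 0 a, indIoc_mem 0 a a.2.1⟩ :=
    Subtype.ext (indIoc_eq_sub a b h)
  rw [this, map_sub, stepIntegral_indIoc_zero, stepIntegral_indIoc_zero]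
  abel

theorem map_stepIntegral {M N : Type*} [AddCommGroup M] [Module ℝ M] [AddCommGroup N] [Module ℝ N]
    (T : M →ₗ[ℝ] N) (F : I → M) (φ : stepFunctions) :
    T (stepIntegral F φ) = stepIntegral (fun t => T (F t)) φ := by
  have : T ∘ₗ stepIntegral F = stepIntegral (fun t => T (F t)) :=
    stepBasis.ext fun t => by simp [stepIntegral, Module.Basis.constr_basis]
  exact LinearMap.congr_fun this φ

/-- `φ ↦ ψ ↦ ∬ φ(s) ψ(t) dR(s,t)` on step functions, a bilinear form with
`∬ 1_{(a,b]}(s) 1_{(c,d]}(t) dR(s,t) = R(b,d) - R(b,c) - R(a,d) + R(a,c)`. -/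
def stepForm (R : I → I → ℝ) : stepFunctions →ₗ[ℝ] stepFunctions →ₗ[ℝ] ℝ :=
  stepIntegral (fun s => stepIntegral (R s))

/-! ### Covariance functions and the Hilbert spaces they induce -/

/-- A covariance function on `[0,1]`: a symmetric positive semidefinite kernel. -/
structure CovarianceFunction where
  toFun : I → I → ℝ
  posSemidef : (Matrix.of toFun).PosSemidef

/-- The bilinear form `(x, y) ↦ ∑ s t, x s * y t * R s t` on finitely supported functions. -/
def kernelForm (R : I → I → ℝ) : (I →₀ ℝ) →ₗ[ℝ] (I →₀ ℝ) →ₗ[ℝ] ℝ :=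
  Finsupp.linearCombination ℝ (fun s => Finsupp.linearCombination ℝ (R s))

theorem kernelForm_apply (R : I → I → ℝ) (x y : I →₀ ℝ) :
    kernelForm R x y = x.sum fun s a => y.sum fun t b => a * R s t * b := by
  simp only [kernelForm, Finsupp.linearCombination_apply, Finsupp.sum, LinearMap.sum_apply,
    LinearMap.smul_apply, smul_eq_mul, Finset.mul_sum]
  refine Finset.sum_congr rfl fun s _ => Finset.sum_congr rfl fun t _ => by ring

theorem stepForm_eq_kernelForm (R : I → I → ℝ) (φ ψ : stepFunctions) :
    stepForm R φ ψ = kernelForm R (stepIntegral (fun t => Finsupp.single t 1) φ)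
      (stepIntegral (fun t => Finsupp.single t 1) ψ) := by
  have h2 : ∀ s : I, kernelForm R (Finsupp.single s 1)
      ∘ₗ stepIntegral (fun t => Finsupp.single t (1 : ℝ)) = stepIntegral (R s) := by
    intro s
    refine LinearMap.ext fun ψ => ?_
    rw [LinearMap.comp_apply, map_stepIntegral]
    simp [kernelForm]
  have h1 := map_stepIntegral
    ((LinearMap.lcomp ℝ ℝ (stepIntegral (fun t => Finsupp.single t (1 : ℝ)))) ∘ₗ kernelForm R)
    (fun t => Finsupp.single t (1 : ℝ)) φ
  have h3 := LinearMap.congr_fun h1 ψ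
  simp only [LinearMap.comp_apply, LinearMap.lcomp_apply] at h3
  rw [h3, stepForm]
  congr 2
  congr 1
  funext s
  exact (h2 s).symm

theorem stepForm_nonneg (R : CovarianceFunction) (φ : stepFunctions) :
    0 ≤ stepForm R.toFun φ φ := by
  rw [stepForm_eq_kernelForm, kernelForm_apply]
  simpa using R.posSemidef.2 (stepIntegral (fun t => Finsupp.single t 1) φ)

theorem stepForm_symm (R : CovarianceFunction) (φ ψ : stepFunctions) :
    stepForm R.toFun φ ψ = stepForm R.toFun ψ φ := by
  have hR : ∀ s t, R.toFun s t = R.toFun t s := fun s t => by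
    simpa using (R.posSemidef.1.apply s t).symm
  simp only [stepForm_eq_kernelForm, kernelForm_apply, Finsupp.sum]
  rw [Finset.sum_comm]
  refine Finset.sum_congr rfl fun s _ => Finset.sum_congr rfl fun t _ => ?_
  rw [hR t s]; ring

/-- The space of step functions, to be endowed with the inner product `∬ φ(s) ψ(t) dR(s,t)`. -/
def StepSpace (_R : CovarianceFunction) : Type := stepFunctions

instance (R : CovarianceFunction) : AddCommGroup (StepSpace R) :=
  inferInstanceAs (AddCommGroup stepFunctions)

instance (R : CovarianceFunction) : Module ℝ (StepSpace R) :=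
  inferInstanceAs (Module ℝ stepFunctions)

/-- A step function, as an element of `StepSpace R`. -/
def toStepSpace (R : CovarianceFunction) : stepFunctions ≃ₗ[ℝ] StepSpace R :=
  LinearEquiv.refl ℝ stepFunctions

/-- `⟨φ, ψ⟩ = ∬ φ(s) ψ(t) dR(s,t)`. -/
@[reducible]
def stepCore (R : CovarianceFunction) : PreInnerProductSpace.Core ℝ (StepSpace R) where
  inner φ ψ := stepForm R.toFun ((toStepSpace R).symm φ) ((toStepSpace R).symm ψ)
  conj_inner_symm φ ψ := by simpa using stepForm_symm R _ _
  re_inner_nonneg φ := by simpa using stepForm_nonneg R _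
  add_left φ ψ χ := by simp
  smul_left φ ψ r := by simp

instance (R : CovarianceFunction) : SeminormedAddCommGroup (StepSpace R) :=
  @InnerProductSpace.Core.toSeminormedAddCommGroup ℝ _ _ _ _ (stepCore R)

instance (R : CovarianceFunction) : InnerProductSpace ℝ (StepSpace R) :=
  InnerProductSpace.ofCore (stepCore R)

/-- The Hilbert space induced by a covariance function: the completion of the step functions
under `⟨φ, ψ⟩ = ∬ φ(s) ψ(t) dR(s,t)` (functions at distance zero being identified). -/
abbrev HilbertOf (R : CovarianceFunction) : Type := UniformSpace.Completion (StepSpace R)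

/-- The class in `HilbertOf R` of a step function. -/
def ofStep (R : CovarianceFunction) : stepFunctions →ₗ[ℝ] HilbertOf R :=
  (UniformSpace.Completion.toComplₗᵢ : StepSpace R →ₗᵢ[ℝ] HilbertOf R).toLinearMap ∘ₗ
    (toStepSpace R).toLinearMap

theorem inner_ofStep (R : CovarianceFunction) (φ ψ : stepFunctions) :
    inner ℝ (ofStep R φ) (ofStep R ψ) = stepForm R.toFun φ ψ :=
  UniformSpace.Completion.inner_coe _ _

/-- Two covariance functions are equivalent if they induce the same Hilbert space, that is, if the
identity of the space of step functions extends to a unitary map between the two completions. -/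
def Equivalent (R₁ R₂ : CovarianceFunction) : Prop :=
  ∃ U : HilbertOf R₁ ≃ₗᵢ[ℝ] HilbertOf R₂, ∀ φ : stepFunctions, U (ofStep R₁ φ) = ofStep R₂ φ

/-- The Hilbert space `H = H₁ ⊕ H₂` of a pair of covariance functions. -/
abbrev PairSpace (R : Fin 2 → CovarianceFunction) : Type := PiLp 2 (fun i => HilbertOf (R i))

/-- The step function `(t, j) ↦ δ_{ij} φ(t)` on `[0,1] × {1,2}`, as an element of `H`. -/
def pairStep (R : Fin 2 → CovarianceFunction) (i : Fin 2) (φ : stepFunctions) : PairSpace R :=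
  WithLp.toLp 2 (Pi.single i (ofStep (R i) φ))

/-! ### Hilbert tensor square and Hilbert–Schmidt operators -/

section Tensor

variable (H : Type*) [NormedAddCommGroup H] [InnerProductSpace ℝ H]

/-- The Hilbert tensor square `H ⊗ H` (completed). -/
abbrev TensorSq : Type _ := UniformSpace.Completion (H ⊗[ℝ] H)

variable {H}

/-- The elementary tensor `g ⊗ h` in the Hilbert tensor square. -/
def tens (g h : H) : TensorSq H := ((g ⊗ₜ[ℝ] h : H ⊗[ℝ] H) : TensorSq H)

variable (H) in
/-- The symmetric Hilbert tensor square: the closed linear span of the tensors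
`g ⊗ h + h ⊗ g`. -/
def symTensorSq : Submodule ℝ (TensorSq H) :=
  (Submodule.span ℝ {f | ∃ g h : H, f = tens g h + tens h g}).topologicalClosure

/-- For `f` in the Hilbert tensor square, the bounded bilinear form `(g, h) ↦ ⟨f, g ⊗ h⟩`. -/
def tensorForm (f : TensorSq H) : H →L[ℝ] H →L[ℝ] ℝ :=
  LinearMap.mkContinuous₂
    (LinearMap.mk₂ ℝ (fun g h => inner ℝ f (tens g h))
      (fun g g' h => by
        simp [tens, TensorProduct.add_tmul, UniformSpace.Completion.coe_add, inner_add_right])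
      (fun c g h => by
        simp only [tens, ← TensorProduct.smul_tmul', UniformSpace.Completion.coe_smul,
          inner_smul_right, smul_eq_mul])
      (fun g h h' => by
        simp [tens, TensorProduct.tmul_add, UniformSpace.Completion.coe_add, inner_add_right])
      (fun c g h => by
        simp [tens, TensorProduct.tmul_smul, UniformSpace.Completion.coe_smul, inner_smul_right]))
    ‖f‖ (fun g h => by
      have h1 := norm_inner_le_norm (𝕜 := ℝ) f (tens g h)
      have h2 : ‖tens g h‖ = ‖g‖ * ‖h‖ := by simp [tens]
      rw [h2, ← mul_assoc] at h1
      exact h1)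

/-- The operator `F` on `H` attached to an element `f` of the Hilbert tensor square:
`⟨F g, h⟩ = ⟨f, g ⊗ h⟩` for all `g`, `h`. -/
def tensorOperator [CompleteSpace H] (f : TensorSq H) : H →L[ℝ] H :=
  (toDual ℝ H).symm.toContinuousLinearEquiv.toContinuousLinearMap.comp (tensorForm f)

theorem inner_tensorOperator [CompleteSpace H] (f : TensorSq H) (g h : H) :
    inner ℝ (tensorOperator f g) h = inner ℝ f (tens g h) :=
  toDual_symm_apply

end Tensor

/-- A bounded operator is Hilbert–Schmidt if `∑ i, ‖F (e i)‖ ^ 2 < ∞` for every Hilbert basis. -/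
def IsHilbertSchmidt {H : Type} [NormedAddCommGroup H] [InnerProductSpace ℝ H]
    (F : H →L[ℝ] H) : Prop :=
  ∀ (ι : Type) (e : HilbertBasis ι ℝ H), Summable (fun i => ‖F (e i)‖ ^ 2)

/-- The positive eigenvalues of a bounded operator. -/
abbrev PosEigenvalues {H : Type} [NormedAddCommGroup H] [InnerProductSpace ℝ H]
    (F : H →L[ℝ] H) : Type :=
  {α : ℝ // 0 < α ∧ Module.End.HasEigenvalue F.toLinearMap α}

/-! ### Riemann–Stieltjes integrals on `[0,1]²` -/

/-- A tagged partition `0 = pt 0 ≤ pt 1 ≤ ⋯ ≤ pt n = 1` of `[0,1]`, `tag k ∈ [pt k, pt (k+1)]`. -/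
structure TaggedPartition where
  n : ℕ
  pt : ℕ → I
  tag : ℕ → I
  mono : Monotone pt
  pt_zero : pt 0 = 0
  pt_last : pt n = 1
  tag_mem : ∀ k, tag k ∈ Set.Icc (pt k) (pt (k + 1))

/-- All the intervals of the partition are shorter than `δ`. -/
def TaggedPartition.MeshLT (D : TaggedPartition) (δ : ℝ) : Prop :=
  ∀ k < D.n, (D.pt (k + 1) : ℝ) - D.pt k < δ

/-- The increment of `R` over `[a,b] × [c,d]`. -/
def rectIncrement (R : I → I → ℝ) (a b c d : I) : ℝ := R b d - R b c - R a d + R a c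

/-- The Riemann–Stieltjes sum of `G` with respect to `dR` over a grid. -/
def riemannSum (G R : I → I → ℝ) (D D' : TaggedPartition) : ℝ :=
  ∑ k ∈ Finset.range D.n, ∑ l ∈ Finset.range D'.n,
    G (D.tag k) (D'.tag l) *
      rectIncrement R (D.pt k) (D.pt (k + 1)) (D'.pt l) (D'.pt (l + 1))

/-- The integral `∬_{[0,1]²} G(x,y) dR(x,y)` exists as a limit of Riemann–Stieltjes sums and
equals `L`. -/
def HasStieltjesIntegral (G R : I → I → ℝ) (L : ℝ) : Prop :=
  ∀ ε > 0, ∃ δ > 0, ∀ D D' : TaggedPartition, D.MeshLT δ → D'.MeshLT δ →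
    |riemannSum G R D D' - L| < ε

/-- The iterated integral `∬ (∬ f(s,u) g(t,v) dR(s,t)) dR'(u,v)` exists and equals `L`. -/
def HasIteratedIntegral (f g R R' : I → I → ℝ) (L : ℝ) : Prop :=
  ∃ Φ : I → I → ℝ, (∀ u v, HasStieltjesIntegral (fun s t => f s u * g t v) R (Φ u v)) ∧
    HasStieltjesIntegral Φ R' L

/-! ### The Lévy kernel and the generalised Lévy area -/

/-- `(1_{s < t} - 1_{s > t}) / 2`. -/
def halfSign (s t : I) : ℝ := if s < t then 1 / 2 else if t < s then -(1 / 2) else 0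

/-- The entries of the Lévy kernel; the indices `0, 1` stand for the two components. -/
def levyKernel (i j : Fin 2) (s t : I) : ℝ :=
  if i = j then 0 else if i = 0 then halfSign s t else -halfSign s t

/-- `f` is the element of the symmetric Hilbert tensor square represented by the Lévy kernel:
for all step functions `g`, which are spanned by the `g_{ij}(t,v) = φ(t) ψ(v)`, one has
`⟨f, g⟩ = ∑ i j, ∬∬ f^L_{ij}(s,u) g_{ij}(t,v) dR_i(s,t) dR_j(u,v)`. -/
def IsLevyElement (R : Fin 2 → CovarianceFunction) (f : TensorSq (PairSpace R)) : Prop :=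
  f ∈ symTensorSq (PairSpace R) ∧
    ∀ (i j : Fin 2) (φ ψ : stepFunctions),
      HasIteratedIntegral (levyKernel i j) (fun t v => φ.1 t * ψ.1 v)
        (R i).toFun (R j).toFun
        (inner ℝ f (tens (pairStep R i φ) (pairStep R j ψ)))

/-! ### Gaussian processes, isonormal process and double integral -/

section Gaussian

variable {Ω : Type*} [MeasurableSpace Ω]

/-- Two independent continuous centered Gaussian processes on `[0,1]`, starting at zero. -/
structure IsGaussianPair (X : Fin 2 → I → Ω → ℝ) (P : Measure Ω) : Prop where
  gaussian : ∀ i, IsGaussianProcess (X i) P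
  centered : ∀ i t, ∫ ω, X i t ω ∂P = 0
  continuous : ∀ i, ∀ᵐ ω ∂P, Continuous (fun t => X i t ω)
  start : ∀ i, ∀ᵐ ω ∂P, X i 0 ω = 0
  indep : IndepFun (fun ω t => X 0 t ω) (fun ω t => X 1 t ω) P

variable {X : Fin 2 → I → Ω → ℝ} {P : Measure Ω}

theorem IsGaussianPair.memLp (hX : IsGaussianPair X P) (i : Fin 2) (t : I) :
    MemLp (X i t) 2 P :=
  ((hX.gaussian i).hasGaussianLaw_eval t).memLp_two

theorem posSemidef_covariance [IsProbabilityMeasure P] {Y : I → Ω → ℝ}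
    (hY : ∀ t, MemLp (Y t) 2 P) :
    (Matrix.of fun s t => cov[Y s, Y t; P]).PosSemidef := by
  refine ⟨?_, fun x => ?_⟩
  · ext s t
    simp [covariance_comm]
  · have h : x.sum (fun s a => x.sum fun t b =>
        star a * (Matrix.of fun s t => cov[Y s, Y t; P]) s t * b)
        = Var[∑ s ∈ x.support, x s • Y s; P] := by
      have hm : MemLp (∑ s ∈ x.support, x s • Y s) 2 P :=
        memLp_finsetSum' _ fun s _ => (hY s).const_smul _
      rw [← covariance_self hm.aestronglyMeasurable.aemeasurable,
        covariance_sum_sum' (fun s _ => (hY s).const_smul _) (fun s _ => (hY s).const_smul _)]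
      simp only [Finsupp.sum, covariance_smul_left, covariance_smul_right]
      refine Finset.sum_congr rfl fun s _ => Finset.sum_congr rfl fun t _ => ?_
      simp; ring
    rw [h]
    exact variance_nonneg _ _

/-- The covariance functions `R_i(s,t) = cov(X_i(s), X_i(t))` of the two processes. -/
def IsGaussianPair.covFun [IsProbabilityMeasure P] (hX : IsGaussianPair X P) (i : Fin 2) :
    CovarianceFunction where
  toFun s t := cov[X i s, X i t; P]
  posSemidef := posSemidef_covariance (hX.memLp i)

variable [IsProbabilityMeasure P]

/-- The Wiener integral of step functions, `1_{(a,b]} ↦ X_i(b) - X_i(a)`. -/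
def IsGaussianPair.stepWiener (hX : IsGaussianPair X P) (i : Fin 2) :
    StepSpace (hX.covFun i) →ₗ[ℝ] Lp ℝ 2 P :=
  stepIntegral (fun t => (hX.memLp i t).toLp (X i t)) ∘ₗ (toStepSpace _).symm.toLinearMap

/-- The isometric extension of the Wiener integral of step functions to `H_i`. -/
def IsGaussianPair.wiener (hX : IsGaussianPair X P) (i : Fin 2) :
    HilbertOf (hX.covFun i) →L[ℝ] Lp ℝ 2 P :=
  (hX.stepWiener i).extendOfNorm
    (UniformSpace.Completion.toComplₗᵢ (𝕜 := ℝ) (E := StepSpace (hX.covFun i))).toLinearMap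

/-- The isonormal process on `H = H₁ ⊕ H₂`: `h ↦ X_1(h_1) + X_2(h_2)`. -/
def IsGaussianPair.isonormal (hX : IsGaussianPair X P) : PairSpace hX.covFun →L[ℝ] Lp ℝ 2 P :=
  ∑ i, (hX.wiener i).comp (PiLp.proj 2 (fun i => HilbertOf (hX.covFun i)) i)

/-- The double Wiener–Itô integral on algebraic tensors, the linear map with
`g ⊗ h ↦ X(g) X(h) - ⟨g, h⟩`; the product of two elements of `L²` is taken in `L¹`. -/
def IsGaussianPair.algDoubleIntegral (hX : IsGaussianPair X P) :
    PairSpace hX.covFun ⊗[ℝ] PairSpace hX.covFun →ₗ[ℝ] Lp ℝ 1 P :=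
  TensorProduct.lift
    (((ContinuousLinearMap.mul ℝ ℝ).holderₗ (μ := P) (p := 2) (q := 2) (r := 1)).compl₁₂
        hX.isonormal.toLinearMap hX.isonormal.toLinearMap
      - (innerₗ (PairSpace hX.covFun)).compr₂
        (LinearMap.toSpanSingleton ℝ (Lp ℝ 1 P) (Lp.const 1 P (1 : ℝ))))

/-- The double Wiener–Itô integral `I₂`: the continuous extension of the previous map to the
Hilbert tensor square of `H`. -/
def IsGaussianPair.doubleIntegral (hX : IsGaussianPair X P) :
    TensorSq (PairSpace hX.covFun) →L[ℝ] Lp ℝ 1 P :=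
  hX.algDoubleIntegral.extendOfNorm
    (UniformSpace.Completion.toComplₗᵢ (𝕜 := ℝ)
      (E := PairSpace hX.covFun ⊗[ℝ] PairSpace hX.covFun)).toLinearMap

end Gaussian

end LevyArea

end

/-!
Equivalent covariance functions have the same increments, so that a Stieltjes integral against one
of them is an integral against the other. Evaluated on step functions, the Lévy kernel then shows
that the operator `F` on `H = H₁ ⊕ H₂` has vanishing diagonal blocks
(`IsLevyElement.inner_diag`) and opposite off-diagonal blocks (`IsLevyElement.inner_offDiag`).
The vanishing of the diagonal means that `F` anticommutes with the reflection `(g, h) ↦ (g, -h)`,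
which therefore exchanges the eigenspaces of `α` and `-α`. With the unitary `U : H₁ → H₂` extending
the identity of step functions, the rotation `J (g, h) = (-U⁻¹ h, U g)` satisfies `J ^ 2 = -1`, and
the relation between the off-diagonal blocks means that `F` commutes with `J`. So `J` acts as a
complex structure on each eigenspace of `F`, whose real dimension is even or infinite.

The operator of any element of the Hilbert tensor square is Hilbert–Schmidt by Bessel's inequality,
and it is compact as a limit of finite rank operators. By the spectral theorem the symmetric element
`f` expands as `∑ α • (e ⊗ e - S e ⊗ S e)`, where `e` runs over orthonormal bases of the
eigenspaces of the positive eigenvalues `α` and `S` is the reflection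
(`hasSum_tens_of_eigenvectors`, `apply_eq_zero_of_orthogonal_eigenFamily`).

The isonormal process maps an orthonormal family to independent standard Gaussian variables
(`IsGaussianPair.isIsonormal`, `IsIsonormal.iIndepFun`). Diagonalizing symmetric algebraic tensors
turns their double integrals into sums of independent centered `χ²` variables; this bounds the
double integral from the tensor norm to `L¹` (`norm_doubleIntegral_le`), so that it does extend
continuously to the completion, and it computes the characteristic function of the partial sums of
the expansion of `f` as a finite product. The square of the characteristic function `χ` of a
centered `χ²` variable is an explicit Gaussian integral, with
`(χ(x) χ(-x)) ^ 2 = 1 / (1 + 4 x ^ 2)`; as every `α` occurs `2m` times and so does `-α`,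
it contributes `1 / (1 + 4 α ^ 2 t ^ 2) ^ m`.
Convergence in `L¹` passes to characteristic functions, and gives the unconditional product.
-/

noncomputable section

namespace LevyArea

/-! ### The Hilbert tensor square -/

section TensorSquare

variable {H : Type*} [NormedAddCommGroup H] [InnerProductSpace ℝ H]

theorem inner_tens_tens (g h g' h' : H) :
    inner ℝ (tens g h) (tens g' h') = inner ℝ g g' * inner ℝ h h' :=
  (UniformSpace.Completion.inner_coe _ _).trans (TensorProduct.inner_tmul _ _ _ _ _)

/-- Elements of the Hilbert tensor square are determined by their pairings with elementary
tensors. -/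
theorem tensorSq_ext {f f' : TensorSq H}
    (h : ∀ x y : H, inner ℝ f (tens x y) = inner ℝ f' (tens x y)) : f = f' := by
  refine ext_inner_right ℝ fun v => ?_
  induction v using UniformSpace.Completion.induction_on with
  | hp => exact isClosed_eq (by fun_prop) (by fun_prop)
  | ih a =>
    induction a using TensorProduct.induction_on with
    | zero => rw [UniformSpace.Completion.coe_zero, inner_zero_right, inner_zero_right]
    | tmul x y => exact h x y
    | add x y hx hy => simp only [UniformSpace.Completion.coe_add, inner_add_right, hx, hy]

theorem inner_tens_comm {f : TensorSq H} (hf : f ∈ symTensorSq H) (x y : H) :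
    inner ℝ f (tens x y) = inner ℝ f (tens y x) := by
  have hcl : IsClosed {f : TensorSq H | inner ℝ f (tens x y) = inner ℝ f (tens y x)} :=
    isClosed_eq (by fun_prop) (by fun_prop)
  refine closure_minimal (fun v hv => ?_) hcl hf
  induction hv using Submodule.span_induction with
  | mem v hv =>
    obtain ⟨g, h, rfl⟩ := hv
    simp only [Set.mem_ofPred_eq, inner_add_left, inner_tens_tens]
    ring
  | zero => simp
  | add v w _ _ hv hw =>
    simp only [Set.mem_ofPred_eq, inner_add_left] at hv hw ⊢
    rw [hv, hw]
  | smul c v _ hv =>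
    simp only [Set.mem_ofPred_eq, inner_smul_left] at hv ⊢
    rw [hv]

theorem orthonormal_tens {ι : Type*} {e : ι → H} (he : Orthonormal ℝ e) :
    Orthonormal ℝ (fun p : ι × ι => tens (e p.1) (e p.2)) := by
  classical
  rw [orthonormal_iff_ite] at he ⊢
  rintro ⟨i, j⟩ ⟨k, l⟩
  rw [inner_tens_tens, he, he]
  by_cases h1 : i = k <;> by_cases h2 : j = l <;> simp [h1, h2]

theorem orthonormal_tens_diag {ι : Type*} {e : ι → H} (he : Orthonormal ℝ e) :
    Orthonormal ℝ (fun i => tens (e i) (e i)) :=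
  (orthonormal_tens he).comp (fun i => (i, i)) fun _ _ h => congrArg Prod.fst h

theorem coe_sum_smul_tmul {ι : Type*} (s : Finset ι) (c : ι → ℝ) (e : ι → H) :
    ((∑ i ∈ s, c i • (e i ⊗ₜ e i) : H ⊗[ℝ] H) : TensorSq H)
      = ∑ i ∈ s, c i • tens (e i) (e i) := by
  have h := map_sum (UniformSpace.Completion.toComplₗᵢ (𝕜 := ℝ) (E := H ⊗[ℝ] H))
    (fun i => c i • (e i ⊗ₜ[ℝ] e i)) s
  simp only [map_smul] at h
  exact h

theorem norm_sum_smul_tmul_sq {ι : Type*} [Fintype ι] {e : ι → H} (he : Orthonormal ℝ e)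
    (c : ι → ℝ) :
    ‖∑ i, c i • (e i ⊗ₜ[ℝ] e i)‖ ^ 2 = ∑ i, c i ^ 2 := by
  classical
  have ho : Orthonormal ℝ fun i => e i ⊗ₜ[ℝ] e i := by
    rw [orthonormal_iff_ite] at he ⊢
    intro i j
    rw [TensorProduct.inner_tmul, he]
    split_ifs <;> simp
  rw [← real_inner_self_eq_norm_sq, ho.inner_sum]
  exact Finset.sum_congr rfl fun i _ => by simp [sq]

variable [CompleteSpace H]

theorem tensorOperator_isSymmetric {f : TensorSq H} (hf : f ∈ symTensorSq H) :
    (tensorOperator f).toLinearMap.IsSymmetric := fun x y => by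
  change inner ℝ (tensorOperator f x) y = inner ℝ x (tensorOperator f y)
  rw [real_inner_comm (tensorOperator f y) x, inner_tensorOperator, inner_tensorOperator,
    inner_tens_comm hf]

theorem tensorOperator_sub (f g : TensorSq H) :
    tensorOperator (f - g) = tensorOperator f - tensorOperator g := by
  refine ContinuousLinearMap.ext fun x => ext_inner_right ℝ fun y => ?_
  simp [inner_tensorOperator, inner_sub_left]

theorem norm_tensorOperator_le (f : TensorSq H) : ‖tensorOperator f‖ ≤ ‖f‖ := by
  refine ContinuousLinearMap.opNorm_le_bound _ (norm_nonneg _) fun x => ?_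
  have : ‖tensorOperator f x‖ = ‖tensorForm f x‖ := by simp [tensorOperator]
  rw [this]
  refine ContinuousLinearMap.opNorm_le_bound _ (by positivity) fun y => ?_
  have h := norm_inner_le_norm (𝕜 := ℝ) f (tens x y)
  have h2 : ‖tens x y‖ = ‖x‖ * ‖y‖ := by simp [tens]
  rw [h2, ← mul_assoc] at h
  exact h

/-- Algebraic tensors have operators of finite rank, and `f ↦ tensorOperator f` is continuous. -/
theorem isCompactOperator_tensorOperator (f : TensorSq H) :
    IsCompactOperator (tensorOperator f) := by
  have hcont : Continuous (tensorOperator : TensorSq H → (H →L[ℝ] H)) := by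
    refine (LipschitzWith.of_dist_le_mul (K := 1) fun f g => ?_).continuous
    rw [dist_eq_norm, dist_eq_norm, ← tensorOperator_sub, NNReal.coe_one, one_mul]
    exact norm_tensorOperator_le _
  have hcl : IsClosed {f : TensorSq H | IsCompactOperator (tensorOperator f)} :=
    isClosed_setOfPred_isCompactOperator.preimage hcont
  induction f using UniformSpace.Completion.induction_on with
  | hp => exact hcl
  | ih a =>
    induction a using TensorProduct.induction_on with
    | zero =>
      have : tensorOperator ((0 : H ⊗[ℝ] H) : TensorSq H) = 0 := by
        refine ContinuousLinearMap.ext fun x => ext_inner_right ℝ fun y => ?_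
        rw [inner_tensorOperator, UniformSpace.Completion.coe_zero]
        simp
      rw [this]
      exact isCompactOperator_zero
    | tmul g h =>
      have : tensorOperator ((g ⊗ₜ[ℝ] h : H ⊗[ℝ] H) : TensorSq H)
          = (ContinuousLinearMap.toSpanSingleton ℝ h).comp (innerSL ℝ g) := by
        refine ContinuousLinearMap.ext fun x => ext_inner_right ℝ fun y => ?_
        rw [inner_tensorOperator]
        change inner ℝ (tens g h) (tens x y) = _
        simp [inner_tens_tens, inner_smul_left]
      rw [this]
      exact (isCompactOperator_of_locallyCompactSpace_dom (innerSL ℝ g)).clm_comp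
        (ContinuousLinearMap.toSpanSingleton ℝ h)
    | add x y hx hy =>
      have : tensorOperator ((x + y : H ⊗[ℝ] H) : TensorSq H)
          = tensorOperator (x : TensorSq H) + tensorOperator (y : TensorSq H) := by
        refine ContinuousLinearMap.ext fun x => ext_inner_right ℝ fun y => ?_
        simp [inner_tensorOperator, inner_add_left, UniformSpace.Completion.coe_add]
      rw [this]
      exact hx.add hy

/-- By Bessel's inequality for the orthonormal family `e i ⊗ e j`, the double series
`∑ i j, ⟨f, e i ⊗ e j⟩ ^ 2 = ∑ i, ‖F (e i)‖ ^ 2` converges. -/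
theorem isHilbertSchmidt_tensorOperator {H : Type} [NormedAddCommGroup H] [InnerProductSpace ℝ H]
    [CompleteSpace H] (f : TensorSq H) : IsHilbertSchmidt (tensorOperator f) := by
  intro ι e
  have hs := (orthonormal_tens e.orthonormal).inner_products_summable f
  have h := hs.prod
  refine h.congr fun i => ?_
  have hp := e.tsum_inner_mul_inner (tensorOperator f (e i)) (tensorOperator f (e i))
  rw [real_inner_self_eq_norm_sq] at hp
  rw [← hp]
  refine tsum_congr fun j => ?_
  rw [real_inner_comm (tensorOperator f (e i)) (e j), inner_tensorOperator, real_inner_comm f,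
    Real.norm_eq_abs, sq_abs, sq]

/-- The spectral expansion of an element of the tensor square along an orthonormal family of
eigenvectors of its operator which spans the complement of the kernel. -/
theorem hasSum_tens_of_eigenvectors {ι : Type*} {f : TensorSq H} {e : ι → H} {c : ι → ℝ}
    (he : Orthonormal ℝ e) (hc : ∀ i, tensorOperator f (e i) = c i • e i)
    (h0 : ∀ x, (∀ i, inner ℝ (e i) x = 0) → tensorOperator f x = 0) :
    HasSum (fun i => c i • tens (e i) (e i)) f := by
  have hcoef : ∀ i, inner ℝ (tens (e i) (e i)) f = c i := fun i => by
    have hi : inner ℝ (e i) (e i) = (1 : ℝ) := by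
      rw [real_inner_self_eq_norm_sq, he.1 i, one_pow]
    rw [real_inner_comm, ← inner_tensorOperator, hc, inner_smul_left, hi]
    simp
  have hsum : Summable fun i => c i • tens (e i) (e i) := by
    have hb := (orthonormal_tens_diag he).inner_products_summable f
    have := ((orthonormal_tens_diag he).orthogonalFamily.summable_iff_norm_sq_summable c).2
      (by simpa only [hcoef] using hb)
    simpa using this
  obtain ⟨g, hg⟩ := hsum
  have hgf : ∀ x y, HasSum (fun i => c i * (inner ℝ (e i) x * inner ℝ (e i) y))
      (inner ℝ (tensorOperator g x) y) := fun x y => by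
    have := (innerSL ℝ (tens x y)).hasSum hg
    rw [inner_tensorOperator, real_inner_comm]
    refine this.congr_fun fun i => ?_
    simp [inner_tens_tens, real_inner_comm (e i)]
  have hge : ∀ i, tensorOperator g (e i) = c i • e i := fun i => by
    refine ext_inner_right ℝ fun y => (hgf (e i) y).unique ?_
    convert hasSum_single i fun j hj => ?_ using 1
    · simp [inner_smul_left, he.1 i]
    · rw [he.2 hj]; ring
  have hg0 : ∀ x, (∀ i, inner ℝ (e i) x = 0) → tensorOperator g x = 0 := fun x hx => by
    refine ext_inner_right ℝ fun y => (hgf x y).unique ?_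
    simp [hx, hasSum_zero]
  suffices h : f = g by rw [h]; exact hg
  -- The operators of `f` and of the sum `g` agree on the closed span of the family and vanish on
  -- its orthogonal complement.
  set K := (Submodule.span ℝ (Set.range e)).topologicalClosure
  have hKe : ∀ i, e i ∈ K := fun i =>
    Submodule.le_topologicalClosure _ (Submodule.subset_span ⟨i, rfl⟩)
  have hon : ∀ x ∈ K, tensorOperator f x = tensorOperator g x := fun x hx => by
    have hcl : IsClosed {x | tensorOperator f x = tensorOperator g x} :=
      isClosed_eq (by fun_prop) (by fun_prop)
    refine closure_minimal (fun v hv => ?_) hcl hx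
    have : Set.EqOn (tensorOperator f).toLinearMap (tensorOperator g).toLinearMap
        (Submodule.span ℝ (Set.range e)) := LinearMap.eqOn_span' (by
      rintro _ ⟨i, rfl⟩
      exact (hc i).trans (hge i).symm)
    exact this hv
  have : CompleteSpace K := (Submodule.isClosed_topologicalClosure _).completeSpace_coe
  have hop : ∀ x, tensorOperator f x = tensorOperator g x := fun x => by
    obtain ⟨y, hy, z, hz, rfl⟩ := K.exists_add_mem_mem_orthogonal x
    have hz' : ∀ i, inner ℝ (e i) z = 0 := fun i =>
      (Submodule.mem_orthogonal K z).1 hz _ (hKe i)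
    rw [map_add, map_add, hon y hy, h0 z hz', hg0 z hz']
  refine tensorSq_ext fun x y => ?_
  rw [← inner_tensorOperator, ← inner_tensorOperator, hop]

theorem tensorOperator_coe_isSymmetric {x : H ⊗[ℝ] H} (hx : TensorProduct.comm ℝ H H x = x) :
    (tensorOperator (x : TensorSq H)).toLinearMap.IsSymmetric := fun a b => by
  have h : ∀ a b : H, inner ℝ (x : TensorSq H) (tens a b) = inner ℝ x (a ⊗ₜ[ℝ] b) :=
    fun a b => UniformSpace.Completion.inner_coe _ _
  change inner ℝ (tensorOperator _ a) b = inner ℝ a (tensorOperator _ b)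
  rw [real_inner_comm (tensorOperator _ b) a, inner_tensorOperator, inner_tensorOperator, h, h]
  have h2 := TensorProduct.inner_comm_comm (𝕜 := ℝ) x (a ⊗ₜ[ℝ] b)
  rw [hx, TensorProduct.comm_tmul] at h2
  exact h2.symm

/-- Diagonalization of symmetric tensors over a Euclidean space. -/
theorem exists_eq_sum_tmul_of_finiteDimensional [FiniteDimensional ℝ H] {x : H ⊗[ℝ] H}
    (hx : TensorProduct.comm ℝ H H x = x) :
    ∃ (n : ℕ) (b : Fin n → H) (c : Fin n → ℝ),
      Orthonormal ℝ b ∧ x = ∑ i, c i • (b i ⊗ₜ b i) := by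
  have hsymm := tensorOperator_coe_isSymmetric hx
  set b := hsymm.eigenvectorBasis rfl
  set c := hsymm.eigenvalues rfl
  have hb : ∀ i, tensorOperator (x : TensorSq H) (b i) = c i • b i :=
    fun i => hsymm.apply_eigenvectorBasis rfl i
  have hs := hasSum_tens_of_eigenvectors b.orthonormal hb fun z hz => by
    have : z = 0 := by
      rw [← b.sum_repr z]
      simp [b.repr_apply_apply, hz]
    rw [this, map_zero]
  refine ⟨_, b, c, b.orthonormal, UniformSpace.Completion.coe_injective _ ?_⟩
  rw [coe_sum_smul_tmul]
  exact hs.unique (hasSum_fintype _)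

omit [CompleteSpace H] in
/-- Diagonalization of symmetric algebraic tensors, which live on a finite-dimensional subspace. -/
theorem exists_eq_sum_tmul {x : H ⊗[ℝ] H} (hx : TensorProduct.comm ℝ H H x = x) :
    ∃ (n : ℕ) (b : Fin n → H) (c : Fin n → ℝ),
      Orthonormal ℝ b ∧ x = ∑ i, c i • (b i ⊗ₜ b i) := by
  obtain ⟨V₁, V₂, _, _, hV⟩ :=
    TensorProduct.exists_finite_submodule_of_setFinite {x} (Set.finite_singleton x)
  obtain ⟨y, hy⟩ : x ∈ LinearMap.range (mapIncl (V₁ ⊔ V₂) (V₁ ⊔ V₂)) :=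
    range_mapIncl_mono le_sup_left le_sup_right (hV rfl)
  generalize hVV : V₁ ⊔ V₂ = V at y hy
  have : FiniteDimensional ℝ V := by rw [← hVV]; infer_instance
  have : CompleteSpace V := FiniteDimensional.complete ℝ V
  have hinj : Function.Injective (mapIncl V V) := fun a b hab => by
    refine (mapInclIsometry V V).injective ?_
    rw [mapInclIsometry_apply, mapInclIsometry_apply, hab]
  have hycomm : TensorProduct.comm ℝ V V y = y := by
    refine hinj ?_
    have h1 : mapIncl V V (TensorProduct.comm ℝ V V y) =
        TensorProduct.comm ℝ H H (mapIncl V V y) := TensorProduct.map_comm _ _ _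
    rw [h1, hy, hx]
  obtain ⟨n, b, c, hb, hyb⟩ := exists_eq_sum_tmul_of_finiteDimensional hycomm
  refine ⟨n, fun i => b i, c, hb.comp_linearIsometry V.subtypeₗᵢ, ?_⟩
  rw [← hy, hyb, map_sum]
  simp [mapIncl]

end TensorSquare

/-! ### Symmetries of the spectrum -/

/-- A linear map `J` with `J ^ 2 = -1` makes a real vector space complex. -/
theorem exists_rank_eq_two_mul {V : Type} [AddCommGroup V] [Module ℝ V] (J : V →ₗ[ℝ] V)
    (hJ : ∀ x, J (J x) = -x) : ∃ c : Cardinal, Module.rank ℝ V = 2 * c := by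
  let φ : ℂ →ₐ[ℝ] Module.End ℝ V := Complex.lift ⟨J, LinearMap.ext fun x => by simp [hJ]⟩
  let : Module ℂ V := Module.compHom V φ.toRingHom
  have : IsScalarTower ℝ ℂ V := ⟨fun r z x => by
    change φ (r • z) x = r • φ z x
    rw [map_smul, LinearMap.smul_apply]⟩
  exact ⟨Module.rank ℂ V, by rw [← rank_mul_rank ℝ ℂ V, Complex.rank_real_complex]⟩

section Symmetry

variable {H : Type} [NormedAddCommGroup H] [NormedSpace ℝ H] {F : H →L[ℝ] H}

theorem exists_rank_eigenspace_eq_two_mul (J : H →ₗ[ℝ] H) (hJ : ∀ x, J (J x) = -x)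
    (hJF : ∀ x, F (J x) = J (F x)) (α : ℝ) :
    ∃ c : Cardinal, Module.rank ℝ (Module.End.eigenspace F.toLinearMap α) = 2 * c := by
  have hmem : ∀ x ∈ Module.End.eigenspace F.toLinearMap α,
      J x ∈ Module.End.eigenspace F.toLinearMap α := fun x hx => by
    rw [Module.End.mem_eigenspace_iff] at hx ⊢
    change F (J x) = α • J x
    rw [hJF, ← map_smul]
    exact congrArg J hx
  exact exists_rank_eq_two_mul (J.restrict hmem) fun x => Subtype.ext (hJ x)

variable (S : H ≃L[ℝ] H) (hSF : ∀ x, F (S x) = -S (F x))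
include hSF

theorem map_mem_eigenspace_neg {α : ℝ} {x : H}
    (hx : x ∈ Module.End.eigenspace F.toLinearMap α) :
    S x ∈ Module.End.eigenspace F.toLinearMap (-α) := by
  rw [Module.End.mem_eigenspace_iff] at hx ⊢
  have hx' : F x = α • x := hx
  change F (S x) = -α • S x
  rw [hSF, hx', map_smul, neg_smul]

theorem symm_anticomm (x : H) : F (S.symm x) = -S.symm (F x) := by
  have := hSF (S.symm x)
  rw [S.apply_symm_apply] at this
  rw [this, map_neg, S.symm_apply_apply, neg_neg]

theorem map_eigenspace (α : ℝ) :
    (Module.End.eigenspace F.toLinearMap α).map (S.toLinearEquiv : H →ₗ[ℝ] H) =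
      Module.End.eigenspace F.toLinearMap (-α) := by
  ext x
  constructor
  · rintro ⟨y, hy, rfl⟩
    exact map_mem_eigenspace_neg S hSF hy
  · intro hx
    refine ⟨S.symm x, ?_, S.apply_symm_apply x⟩
    have := map_mem_eigenspace_neg S.symm (symm_anticomm S hSF) hx
    rwa [neg_neg] at this

theorem rank_eigenspace_neg (α : ℝ) : Module.rank ℝ (Module.End.eigenspace F.toLinearMap (-α)) =
    Module.rank ℝ (Module.End.eigenspace F.toLinearMap α) := by
  rw [← map_eigenspace S hSF α]
  exact LinearEquiv.rank_map_eq S.toLinearEquiv _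

theorem neg_mem_spectrum {α : ℝ} (hα : α ∈ spectrum ℝ F) : -α ∈ spectrum ℝ F := by
  have h1 : -F = S.toContinuousLinearMap * F * S.symm.toContinuousLinearMap := by
    refine ContinuousLinearMap.ext fun x => ?_
    have := hSF (S.symm x)
    rw [S.apply_symm_apply] at this
    simp [this]
  let u : (H →L[ℝ] H)ˣ := ⟨S, S.symm, by ext; simp, by ext; simp⟩
  have h2 : spectrum ℝ (-F) = spectrum ℝ F := by
    rw [h1]
    exact spectrum.units_conjugate (u := u)
  rw [← h2, ← spectrum.neg_eq]
  simpa using hα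

end Symmetry

/-! ### Isonormal Gaussian processes -/

section Isonormal

variable {Ω : Type*} [MeasurableSpace Ω] {P : Measure Ω} [IsProbabilityMeasure P]
variable {H : Type*} [NormedAddCommGroup H] [InnerProductSpace ℝ H]

/-- An isonormal Gaussian process over `H`: a linear map to `L²(P)` such that `W h` is centered
Gaussian of variance `‖h‖ ^ 2` for every `h`, encoded by the characteristic functions at `1`. -/
def IsIsonormal (W : H →L[ℝ] Lp ℝ 2 P) : Prop :=
  ∀ h, ∫ ω, Complex.exp (W h ω * Complex.I) ∂P = Complex.exp (-(‖h‖ ^ 2 : ℝ) / 2)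

omit [IsProbabilityMeasure P] in
theorem aemeasurable_Lp {p : ENNReal} (Y : Lp ℝ p P) : AEMeasurable Y P :=
  (Lp.aestronglyMeasurable Y).aemeasurable

theorem integral_norm_le_norm_Lp {p : ENNReal} [Fact (1 ≤ p)] (Y : Lp ℝ p P) :
    ∫ ω, ‖Y ω‖ ∂P ≤ ‖Y‖ := by
  rw [integral_norm_eq_lintegral_enorm (Lp.aestronglyMeasurable Y),
    ← eLpNorm_one_eq_lintegral_enorm, Lp.norm_def]
  exact ENNReal.toReal_mono (Lp.eLpNorm_ne_top Y)
    (eLpNorm_le_eLpNorm_of_exponent_le Fact.out (Lp.aestronglyMeasurable Y))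

/-- The characteristic function at `1` of a real element of `Lp` depends continuously on that
element. -/
theorem continuous_integral_exp {p : ENNReal} [Fact (1 ≤ p)] :
    Continuous fun Y : Lp ℝ p P => ∫ ω, Complex.exp (Y ω * Complex.I) ∂P := by
  have hint : ∀ Y : Lp ℝ p P, Integrable (fun ω => Complex.exp (Y ω * Complex.I)) P := fun Y => by
    refine Integrable.of_bound (C := 1) ?_ (Filter.Eventually.of_forall fun ω => ?_)
    · exact (by fun_prop : Measurable fun x : ℝ => Complex.exp (x * Complex.I)).comp_aemeasurable
        (aemeasurable_Lp Y) |>.aestronglyMeasurable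
    · rw [Complex.norm_exp_ofReal_mul_I]
  refine (LipschitzWith.of_dist_le_mul (K := 1) fun Y Z => ?_).continuous
  rw [dist_eq_norm, dist_eq_norm, ← integral_sub (hint Y) (hint Z), NNReal.coe_one, one_mul]
  refine le_trans ?_ (integral_norm_le_norm_Lp (Y - Z))
  refine norm_integral_le_of_norm_le ((Lp.memLp _).integrable Fact.out).norm ?_
  filter_upwards [Lp.coeFn_sub Y Z] with ω hω
  rw [hω, Pi.sub_apply]
  have h1 : Complex.exp (Y ω * Complex.I) - Complex.exp (Z ω * Complex.I)
      = Complex.exp (Z ω * Complex.I) * (Complex.exp (Complex.I * (Y ω - Z ω : ℝ)) - 1) := by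
    rw [mul_sub, mul_one, ← Complex.exp_add]
    push_cast
    ring_nf
  rw [h1, norm_mul, Complex.norm_exp_ofReal_mul_I, one_mul]
  exact Real.norm_exp_I_mul_ofReal_sub_one_le

namespace IsIsonormal

variable {W : H →L[ℝ] Lp ℝ 2 P}

omit [IsProbabilityMeasure P] in
theorem integral_exp_smul (hW : IsIsonormal W) (h : H) (t : ℝ) :
    ∫ ω, Complex.exp (t * W h ω * Complex.I) ∂P = Complex.exp (-(t ^ 2 * ‖h‖ ^ 2 : ℝ) / 2) := by
  have := hW (t • h)
  rw [norm_smul, mul_pow, Real.norm_eq_abs, sq_abs] at this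
  rw [← this]
  refine integral_congr_ae ?_
  rw [map_smul]
  filter_upwards [Lp.coeFn_smul t (W h)] with ω hω
  simp [hω]

theorem map_eq (hW : IsIsonormal W) {h : H} (hh : ‖h‖ = 1) :
    P.map (W h) = gaussianReal 0 1 := by
  have := Measure.isProbabilityMeasure_map (aemeasurable_Lp (P := P) (W h))
  refine Measure.ext_of_charFun (funext fun t => ?_)
  rw [charFun_gaussianReal, charFun_apply_real,
    integral_map (aemeasurable_Lp _) (by fun_prop), hW.integral_exp_smul, hh]
  congr 1
  push_cast
  ring

theorem iIndepFun {ι : Type*} [Fintype ι] (hW : IsIsonormal W) {e : ι → H}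
    (he : Orthonormal ℝ e) : iIndepFun (fun i => (W (e i) : Ω → ℝ)) P := by
  classical
  rw [iIndepFun_iff_charFun_pi fun i => aemeasurable_Lp _]
  intro t
  have hm : AEMeasurable (fun ω => WithLp.toLp 2 (fun i => W (e i) ω)) P :=
    (PiLp.continuous_toLp 2 (fun _ : ι => ℝ)).measurable.comp_aemeasurable
      (aemeasurable_pi_lambda _ fun i => aemeasurable_Lp _)
  rw [charFun_apply, integral_map hm (by fun_prop)]
  have hsum : ‖∑ i, t i • e i‖ ^ 2 = ∑ i, t i ^ 2 := by
    rw [← real_inner_self_eq_norm_sq, he.inner_sum]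
    exact Finset.sum_congr rfl fun i _ => by simp [sq]
  have h1 := hW (∑ i, t i • e i)
  rw [hsum] at h1
  have h2 : ∀ i, charFun (P.map (W (e i))) (t i) = Complex.exp (-(t i ^ 2 : ℝ) / 2) := fun i => by
    rw [hW.map_eq (he.1 i), charFun_gaussianReal]
    simp [neg_div]
  simp only [h2]
  rw [← Complex.exp_sum, ← Finset.sum_div, Finset.sum_neg_distrib, ← Complex.ofReal_sum, ← h1]
  refine integral_congr_ae ?_
  have h3 : ∀ᵐ ω ∂P, ∀ i, (t i • W (e i) : Lp ℝ 2 P) ω = t i * W (e i) ω :=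
    ae_all_iff.2 fun i => by
      filter_upwards [Lp.coeFn_smul (t i) (W (e i))] with ω hω
      simp [hω]
  rw [map_sum]
  simp only [map_smul]
  filter_upwards [Lp.coeFn_fun_finsetSum Finset.univ fun i => t i • W (e i), h3] with ω hω h3
  rw [hω]
  simp only [h3, PiLp.inner_apply]
  congr 3

end IsIsonormal

/-- The characteristic function of a centered `χ²` variable with one degree of freedom. -/
def chiSqCharFun (x : ℝ) : ℂ :=
  ∫ y, Complex.exp ((x * (y ^ 2 - 1) : ℝ) * Complex.I) ∂(gaussianReal 0 1)

/-- Squaring the Gaussian integral avoids choosing a branch of the square root. -/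
theorem chiSqCharFun_sq (x : ℝ) :
    chiSqCharFun x ^ 2 = Complex.exp (-(2 * x * Complex.I)) / (1 - 2 * x * Complex.I) := by
  have hb : 0 < (1 / 2 - x * Complex.I : ℂ).re := by simp
  have h0 : (1 / 2 - x * Complex.I : ℂ) ≠ 0 := fun h => by rw [h] at hb; simp at hb
  have h0' : (1 - 2 * x * Complex.I : ℂ) ≠ 0 := fun h => h0 (by linear_combination h / 2)
  have hpi : (Real.pi : ℂ) ≠ 0 := by exact_mod_cast Real.pi_ne_zero
  have h1 : chiSqCharFun x = Complex.exp (-(x * Complex.I)) * ((√(2 * Real.pi))⁻¹ : ℝ) *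
      ∫ y : ℝ, Complex.exp (-(1 / 2 - x * Complex.I) * (y : ℂ) ^ 2) := by
    rw [chiSqCharFun, integral_gaussianReal_eq_integral_smul one_ne_zero, ← integral_const_mul]
    congr 1
    funext y
    rw [gaussianPDFReal, Complex.real_smul]
    push_cast
    rw [mul_assoc, mul_comm (Complex.exp (-(x * Complex.I))), mul_assoc (_⁻¹),
      ← Complex.exp_add, ← Complex.exp_add]
    simp only [mul_one]
    congr 2
    ring
  have h2 : (((√(2 * Real.pi))⁻¹ : ℝ) : ℂ) ^ 2 = (2 * Real.pi)⁻¹ := by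
    rw [← Complex.ofReal_pow, inv_pow, Real.sq_sqrt (by positivity)]
  rw [h1, mul_pow, mul_pow, integral_gaussian_sq_complex hb, h2, ← Complex.exp_nat_mul]
  have h3 : ((2 : ℕ) : ℂ) * -(x * Complex.I) = -(2 * x * Complex.I) := by push_cast; ring
  rw [h3]
  push_cast
  field_simp

theorem chiSqCharFun_mul_neg_sq (x : ℝ) :
    (chiSqCharFun x * chiSqCharFun (-x)) ^ 2 = (((1 + 4 * x ^ 2)⁻¹ : ℝ) : ℂ) := by
  rw [mul_pow, chiSqCharFun_sq, chiSqCharFun_sq, div_mul_div_comm, ← Complex.exp_add]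
  have h1 : -(2 * (x : ℂ) * Complex.I) + -(2 * ((-x : ℝ) : ℂ) * Complex.I) = 0 := by
    push_cast; ring
  rw [h1, Complex.exp_zero, one_div, Complex.ofReal_inv]
  congr 1
  push_cast
  linear_combination (-4 * (x : ℂ) ^ 2) * Complex.I_sq

/-! ### The double Wiener–Itô integral -/

section DoubleIntegral

variable {W : H →L[ℝ] Lp ℝ 2 P} {D : H ⊗[ℝ] H →ₗ[ℝ] Lp ℝ 1 P}

/-- The variance of a `χ²` variable with one degree of freedom. Its value `2` plays no role. -/
def chiSqVariance : ℝ := Var[fun y => y ^ 2 - 1; gaussianReal 0 1]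

theorem memLp_sq_sub_one : MemLp (fun y : ℝ => y ^ 2 - 1) 2 (gaussianReal 0 1) := by
  have h := (memLp_id_gaussianReal' (μ := 0) (v := 1) 4 (by simp))
  have h2 : MemLp (fun y : ℝ => y ^ 2) 2 (gaussianReal 0 1) := by
    have : ENNReal.HolderTriple 4 4 2 := ⟨by
      rw [← two_mul, show (4 : ENNReal) = 2 * 2 by norm_num,
        ENNReal.mul_inv (by simp) (by simp), ← mul_assoc, ENNReal.mul_inv_cancel (by simp)
        (by simp), one_mul]⟩
    have := MemLp.mul (p := 4) (q := 4) (r := 2) h h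
    refine this.ae_eq (Filter.Eventually.of_forall fun y => ?_)
    simp [sq]
  exact h2.sub (memLp_const 1)

theorem integral_sq_sub_one : ∫ y : ℝ, (y ^ 2 - 1) ∂(gaussianReal 0 1) = 0 := by
  have hm : MemLp (id : ℝ → ℝ) 2 (gaussianReal 0 1) := memLp_id_gaussianReal' 2 (by simp)
  have h := variance_eq_sub hm
  rw [variance_id_gaussianReal] at h
  have h1 : ∫ y : ℝ, y ^ 2 ∂(gaussianReal 0 1) = 1 := by
    simp at h
    exact h.symm
  rw [integral_sub, h1]
  · simp
  · exact hm.integrable_sq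
  · exact integrable_const _

theorem norm_sum_sq_sub_one_le {ι : Type*} [Fintype ι] (hW : IsIsonormal W) {e : ι → H}
    (he : Orthonormal ℝ e) (c : ι → ℝ) :
    (∫ ω, |∑ i, c i * (W (e i) ω ^ 2 - 1)| ∂P) ^ 2 ≤ chiSqVariance * ∑ i, c i ^ 2 := by
  set Y : ι → Ω → ℝ := fun i ω => c i * (W (e i) ω ^ 2 - 1) with hY
  have hm0 : ∀ i, MemLp (fun ω => W (e i) ω ^ 2 - 1) 2 P := fun i => by
    have := memLp_sq_sub_one
    rw [← hW.map_eq (he.1 i)] at this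
    exact this.comp_of_map (aemeasurable_Lp _)
  have hm : ∀ i, MemLp (Y i) 2 P := fun i => (hm0 i).const_mul _
  have hint : ∀ i, ∫ ω, Y i ω ∂P = 0 := fun i => by
    rw [hY]
    simp only [integral_const_mul]
    have : ∫ ω, (W (e i) ω ^ 2 - 1) ∂P = ∫ y : ℝ, (y ^ 2 - 1) ∂(P.map (W (e i))) :=
      (integral_map (f := fun y : ℝ => y ^ 2 - 1) (aemeasurable_Lp _) (by fun_prop)).symm
    rw [this, hW.map_eq (he.1 i), integral_sq_sub_one, mul_zero]
  have hvar : ∀ i, Var[Y i; P] = c i ^ 2 * chiSqVariance := fun i => by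
    rw [hY]
    simp only [variance_const_mul]
    rw [chiSqVariance, ← hW.map_eq (he.1 i), variance_map (by fun_prop) (aemeasurable_Lp _)]
    rfl
  have hind : ∀ i j, i ≠ j → IndepFun (Y i) (Y j) P := fun i j hij =>
    ((hW.iIndepFun he).indepFun hij).comp (φ := fun y => c i * (y ^ 2 - 1))
      (ψ := fun y => c j * (y ^ 2 - 1)) (by fun_prop) (by fun_prop)
  have hZ : MemLp (fun ω => ∑ i, Y i ω) 2 P := memLp_finsetSum _ fun i _ => hm i
  have hsum : Var[fun ω => ∑ i, Y i ω; P] = chiSqVariance * ∑ i, c i ^ 2 := by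
    have := IndepFun.variance_sum (s := Finset.univ) (fun i _ => hm i)
      (fun i _ j _ hij => hind i j hij)
    rw [Finset.mul_sum]
    simp only [hvar] at this
    rw [← Finset.sum_fn, this]
    exact Finset.sum_congr rfl fun i _ => mul_comm _ _
  have hZ0 : ∫ ω, ∑ i, Y i ω ∂P = 0 := by
    rw [integral_finsetSum _ fun i _ => (hm i).integrable (by norm_num)]
    simp [hint]
  have h1 := variance_eq_sub hZ
  have h2 := variance_eq_sub hZ.abs
  have h3 : 0 ≤ Var[|fun ω => ∑ i, Y i ω|; P] := variance_nonneg _ _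
  rw [h2] at h3
  rw [hsum, hZ0] at h1
  simp only [Pi.pow_apply, Pi.abs_apply, sq_abs] at h1 h3
  linarith

variable (hD : ∀ g h : H, D (g ⊗ₜ h) =ᵐ[P] fun ω => W g ω * W h ω - inner ℝ g h)
include hD

omit [IsProbabilityMeasure P] in
theorem doubleIntegral_comm (x : H ⊗[ℝ] H) : D (TensorProduct.comm ℝ H H x) = D x := by
  induction x using TensorProduct.induction_on with
  | zero => simp
  | tmul g h =>
    rw [TensorProduct.comm_tmul]
    refine Lp.ext ?_
    filter_upwards [hD g h, hD h g] with ω h1 h2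
    rw [h1, h2, real_inner_comm, mul_comm]
  | add x y hx hy => rw [map_add, map_add, map_add, hx, hy]

omit [IsProbabilityMeasure P] in
theorem doubleIntegral_sum_tmul {ι : Type*} (s : Finset ι) {e : ι → H} (he : Orthonormal ℝ e)
    (c : ι → ℝ) :
    D (∑ i ∈ s, c i • (e i ⊗ₜ e i)) =ᵐ[P] fun ω => ∑ i ∈ s, c i * (W (e i) ω ^ 2 - 1) := by
  rw [map_sum]
  have h3 : ∀ᵐ ω ∂P, ∀ i ∈ s, (D (c i • (e i ⊗ₜ e i)) : Lp ℝ 1 P) ω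
      = c i * (W (e i) ω ^ 2 - 1) :=
    (Filter.eventually_all_finset s).2 fun i _ => by
      rw [map_smul]
      filter_upwards [Lp.coeFn_smul (c i) (D (e i ⊗ₜ e i)), hD (e i) (e i)] with ω h1 h2
      rw [h1, Pi.smul_apply, h2, real_inner_self_eq_norm_sq, he.1 i]
      simp [sq]
  filter_upwards [Lp.coeFn_fun_finsetSum s fun i => D (c i • (e i ⊗ₜ e i)), h3] with ω h1 h2
  rw [h1]
  exact Finset.sum_congr rfl h2

/-- A symmetric tensor is diagonal in an orthonormal family, so that its double integral is a sum
of independent centered variables. -/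
theorem norm_doubleIntegral_le_of_comm (hW : IsIsonormal W) {x : H ⊗[ℝ] H}
    (hx : TensorProduct.comm ℝ H H x = x) : ‖D x‖ ≤ √chiSqVariance * ‖x‖ := by
  obtain ⟨n, b, c, hbo, hxsum⟩ := exists_eq_sum_tmul hx
  have hnorm : ‖x‖ ^ 2 = ∑ i, c i ^ 2 := by rw [hxsum, norm_sum_smul_tmul_sq hbo]
  have hle := norm_sum_sq_sub_one_le hW hbo c
  rw [← hnorm] at hle
  have hn : ‖D x‖ = ∫ ω, |∑ i, c i * (W (b i) ω ^ 2 - 1)| ∂P := by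
    rw [L1.norm_eq_integral_norm, hxsum]
    refine integral_congr_ae ?_
    filter_upwards [doubleIntegral_sum_tmul hD Finset.univ hbo c] with ω hω
    rw [hω, Real.norm_eq_abs]
  rw [← hn] at hle
  have h0 : 0 ≤ chiSqVariance := variance_nonneg _ _
  refine abs_le_of_sq_le_sq' ?_ (by positivity) |>.2
  rwa [mul_pow, Real.sq_sqrt h0]

theorem norm_doubleIntegral_le (hW : IsIsonormal W) (x : H ⊗[ℝ] H) :
    ‖D x‖ ≤ √chiSqVariance * ‖x‖ := by
  -- Symmetrizing keeps the double integral and does not increase the norm.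
  set y := (1 / 2 : ℝ) • (x + TensorProduct.comm ℝ H H x) with hy
  have hDy : D y = D x := by
    rw [hy, map_smul, map_add, doubleIntegral_comm hD, ← two_smul ℝ, smul_smul]
    norm_num
  have hcomm : TensorProduct.comm ℝ H H y = y := by
    rw [hy, map_smul, map_add, TensorProduct.comm_comm, add_comm]
  have hle : ‖y‖ ≤ ‖x‖ := by
    rw [hy, norm_smul]
    have := norm_add_le x (TensorProduct.comm ℝ H H x)
    rw [TensorProduct.norm_comm] at this
    norm_num
    linarith
  rw [← hDy]
  exact (norm_doubleIntegral_le_of_comm hD hW hcomm).trans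
    (mul_le_mul_of_nonneg_left hle (Real.sqrt_nonneg _))

theorem integral_exp_doubleIntegral_sum {ι : Type*} (hW : IsIsonormal W)
    {T : TensorSq H →L[ℝ] Lp ℝ 1 P} (hT : ∀ x : H ⊗[ℝ] H, T x = D x) (s : Finset ι)
    {e : ι → H} (he : Orthonormal ℝ e) (c : ι → ℝ) (t : ℝ) :
    ∫ ω, Complex.exp ((t • T (∑ i ∈ s, c i • tens (e i) (e i)) : Lp ℝ 1 P) ω * Complex.I) ∂P =
      ∏ i ∈ s, chiSqCharFun (c i * t) := by
  rw [← coe_sum_smul_tmul, hT]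
  have hes : Orthonormal ℝ fun i : s => e i := he.comp _ Subtype.val_injective
  have h3 := (hW.iIndepFun hes).integral_fun_prod_comp (𝕜 := ℂ)
    (f := fun (i : s) (y : ℝ) => Complex.exp ((c i * t * (y ^ 2 - 1) : ℝ) * Complex.I))
    (fun i => aemeasurable_Lp _) (fun i => by fun_prop)
  have h4 : ∀ i : s, ∫ ω, Complex.exp ((c i * t * (W (e i) ω ^ 2 - 1) : ℝ) * Complex.I) ∂P
      = chiSqCharFun (c i * t) := fun i => by
    rw [chiSqCharFun, ← hW.map_eq (he.1 i), integral_map (aemeasurable_Lp _) (by fun_prop)]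
  rw [← Finset.prod_coe_sort s fun i => chiSqCharFun (c i * t)]
  simp only [h4] at h3
  rw [← h3]
  refine integral_congr_ae ?_
  filter_upwards [Lp.coeFn_smul t (D (∑ i ∈ s, c i • (e i ⊗ₜ e i))),
    doubleIntegral_sum_tmul hD s he c] with ω h5 h6
  rw [h5, Pi.smul_apply, h6, ← Complex.exp_sum, ← Finset.sum_mul, ← Complex.ofReal_sum,
    Finset.sum_coe_sort s fun i => c i * t * (W (e i) ω ^ 2 - 1), smul_eq_mul, Finset.mul_sum]
  congr 3
  exact Finset.sum_congr rfl fun i _ => by ring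

end DoubleIntegral

end Isonormal

/-! ### The isonormal process of a Gaussian pair -/

theorem inner_stepIntegral {E : Type*} [NormedAddCommGroup E] [InnerProductSpace ℝ E]
    (Y : I → E) (φ ψ : stepFunctions) :
    inner ℝ (stepIntegral Y φ) (stepIntegral Y ψ) =
      stepForm (fun s t => inner ℝ (Y s) (Y t)) φ ψ := by
  have h := map_stepIntegral
    ((LinearMap.lcomp ℝ ℝ (stepIntegral Y)) ∘ₗ innerₗ E) Y φ
  have h2 : ∀ s, ((LinearMap.lcomp ℝ ℝ (stepIntegral Y)) ∘ₗ innerₗ E) (Y s) =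
      stepIntegral (fun t => inner ℝ (Y s) (Y t)) := fun s =>
    LinearMap.ext fun ψ => map_stepIntegral (innerₗ E (Y s)) Y ψ
  simp only [h2] at h
  exact LinearMap.congr_fun h ψ

/-- The inclusion of `H_i` in `H = H₁ ⊕ H₂`. -/
def pairIncl (R : Fin 2 → CovarianceFunction) (i : Fin 2) : HilbertOf (R i) →L[ℝ] PairSpace R :=
  (PiLp.continuousLinearEquiv 2 ℝ (fun i => HilbertOf (R i))).symm.toContinuousLinearMap.comp
    (ContinuousLinearMap.single ℝ (fun i => HilbertOf (R i)) i)

theorem pairIncl_apply (R : Fin 2 → CovarianceFunction) (i : Fin 2) (h : HilbertOf (R i)) :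
    pairIncl R i h = WithLp.toLp 2 (Pi.single i h) := rfl

theorem pairIncl_ofStep (R : Fin 2 → CovarianceFunction) (i : Fin 2) (φ : stepFunctions) :
    pairIncl R i (ofStep (R i) φ) = pairStep R i φ := rfl

theorem inner_pairIncl (R : Fin 2 → CovarianceFunction) (i : Fin 2) (h : HilbertOf (R i))
    (x : PairSpace R) : inner ℝ (pairIncl R i h) x = inner ℝ h (x i) := by
  rw [PiLp.inner_apply, Finset.sum_eq_single i]
  · simp [pairIncl_apply]
  · intro j _ hj
    simp [pairIncl_apply, hj]
  · simp

theorem eq_pairIncl_add (R : Fin 2 → CovarianceFunction) (x : PairSpace R) :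
    x = pairIncl R 0 (x 0) + pairIncl R 1 (x 1) := by
  ext i
  fin_cases i <;> simp [pairIncl_apply]

namespace IsGaussianPair

variable {Ω : Type*} [MeasurableSpace Ω] {P : Measure Ω} [IsProbabilityMeasure P]
variable {X : Fin 2 → I → Ω → ℝ}

theorem inner_stepWiener (hX : IsGaussianPair X P) (i : Fin 2) (φ ψ : StepSpace (hX.covFun i)) :
    inner ℝ (hX.stepWiener i φ) (hX.stepWiener i ψ) = inner ℝ φ ψ := by
  have h1 : ∀ χ, hX.stepWiener i χ = stepIntegral (fun t => (hX.memLp i t).toLp (X i t))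
      ((toStepSpace (hX.covFun i)).symm χ) := fun χ => rfl
  have : (fun s t => inner ℝ ((hX.memLp i s).toLp (X i s)) ((hX.memLp i t).toLp (X i t)))
      = (hX.covFun i).toFun := by
    funext s t
    change _ = cov[X i s, X i t; P]
    rw [covariance_eq_sub (hX.memLp i s) (hX.memLp i t), hX.centered, zero_mul, sub_zero,
      L2.inner_def]
    refine integral_congr_ae ?_
    filter_upwards [(hX.memLp i s).coeFn_toLp, (hX.memLp i t).coeFn_toLp] with ω h1 h2
    rw [h1, h2]
    simp [mul_comm]
  rw [h1, h1, inner_stepIntegral, this]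
  rfl

theorem norm_stepWiener (hX : IsGaussianPair X P) (i : Fin 2) (φ : StepSpace (hX.covFun i)) :
    ‖hX.stepWiener i φ‖ = ‖φ‖ := by
  rw [@norm_eq_sqrt_real_inner, @norm_eq_sqrt_real_inner (StepSpace (hX.covFun i)),
    inner_stepWiener]

theorem wiener_coe (hX : IsGaussianPair X P) (i : Fin 2) (φ : StepSpace (hX.covFun i)) :
    hX.wiener i (φ : HilbertOf (hX.covFun i)) = hX.stepWiener i φ :=
  LinearMap.extendOfNorm_eq (f := hX.stepWiener i)
    (e := (UniformSpace.Completion.toComplₗᵢ (𝕜 := ℝ)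
      (E := StepSpace (hX.covFun i))).toLinearMap)
    UniformSpace.Completion.denseRange_coe
    ⟨1, fun φ => by
      rw [norm_stepWiener, one_mul]
      exact (UniformSpace.Completion.norm_coe φ).ge⟩ φ

theorem exists_stepWiener_ae_eq (hX : IsGaussianPair X P) (i : Fin 2)
    (φ : StepSpace (hX.covFun i)) :
    ∃ (s : Finset I) (c : I → ℝ), hX.stepWiener i φ =ᵐ[P] fun ω => ∑ t ∈ s, c t * X i t ω := by
  classical
  set Y : I → Lp ℝ 2 P := fun t => (hX.memLp i t).toLp (X i t) with hY
  have hY0 : Y 0 = 0 := by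
    rw [← (MemLp.zero : MemLp (0 : Ω → ℝ) 2 P).toLp_zero]
    exact (MemLp.toLp_eq_toLp_iff _ _).2 (hX.start i)
  set r := stepBasis.repr ((toStepSpace (hX.covFun i)).symm φ) with hr
  have h1 : hX.stepWiener i φ = ∑ t ∈ r.support, r t • Y t := by
    change stepIntegral Y ((toStepSpace (hX.covFun i)).symm φ) = _
    rw [stepIntegral, Module.Basis.constr_apply, Finsupp.sum]
    simp [hY0, hr]
  set c : I → ℝ := fun t => if h : t ∈ Set.Ioi (0 : I) then r ⟨t, h⟩ else 0 with hc
  refine ⟨r.support.map (Function.Embedding.subtype _), c, ?_⟩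
  have h2 : ∀ᵐ ω ∂P, ∀ t ∈ r.support, (r t • Y t : Lp ℝ 2 P) ω = c t * X i t ω :=
    (Filter.eventually_all_finset _).2 fun t _ => by
      filter_upwards [Lp.coeFn_smul (r t) (Y t), (hX.memLp i t).coeFn_toLp] with ω h3 h4
      have hct : c t = r t := by
        rw [hc]
        exact dif_pos t.2
      rw [h3, Pi.smul_apply, hY, h4, hct, smul_eq_mul]
  rw [h1]
  filter_upwards [Lp.coeFn_fun_finsetSum r.support fun t => r t • Y t, h2] with ω h3 h4
  rw [h3, Finset.sum_map]
  exact Finset.sum_congr rfl h4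

theorem charFun_map_stepWiener (hX : IsGaussianPair X P) (i : Fin 2)
    (φ : StepSpace (hX.covFun i)) :
    charFun (P.map (hX.stepWiener i φ)) 1 = Complex.exp (-(‖φ‖ ^ 2 : ℝ) / 2) := by
  obtain ⟨s, c, h⟩ := hX.exists_stepWiener_ae_eq i φ
  have hs : HasGaussianLaw (fun ω => ∑ t ∈ s, c t • X i t ω) P :=
    ((hX.gaussian i).smul c).hasGaussianLaw_fun_sum
  have hg : HasGaussianLaw (hX.stepWiener i φ) P := hs.congr h.symm
  have h0 : ∫ ω, hX.stepWiener i φ ω ∂P = 0 := by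
    rw [integral_congr_ae h, integral_finsetSum]
    · simp [integral_const_mul, hX.centered]
    · exact fun t _ => ((hX.memLp i t).integrable (by norm_num)).const_mul _
  have hv : Var[hX.stepWiener i φ; P] = ‖φ‖ ^ 2 := by
    rw [variance_of_integral_eq_zero (aemeasurable_Lp _) h0, ← hX.norm_stepWiener,
      ← real_inner_self_eq_norm_sq, L2.inner_def]
    refine integral_congr_ae (Filter.Eventually.of_forall fun ω => ?_)
    simp [sq]
  rw [hg.map_eq_gaussianReal, charFun_gaussianReal, h0, hv, Real.coe_toNNReal _ (by positivity)]
  congr 1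
  push_cast
  ring

theorem isonormal_pairIncl_add (hX : IsGaussianPair X P) (g : HilbertOf (hX.covFun 0))
    (h : HilbertOf (hX.covFun 1)) :
    hX.isonormal (pairIncl _ 0 g + pairIncl _ 1 h) = hX.wiener 0 g + hX.wiener 1 h := by
  simp [isonormal, Fin.sum_univ_two, pairIncl_apply]

theorem norm_pairIncl_add_sq (R : Fin 2 → CovarianceFunction) (g : HilbertOf (R 0))
    (h : HilbertOf (R 1)) : ‖pairIncl R 0 g + pairIncl R 1 h‖ ^ 2 = ‖g‖ ^ 2 + ‖h‖ ^ 2 := by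
  rw [PiLp.norm_sq_eq_of_L2, Fin.sum_univ_two]
  simp [pairIncl_apply]

/-- On step functions this is the computation of the characteristic function of the sum of two
independent Gaussian variables; both sides are continuous on `H`. -/
theorem isIsonormal (hX : IsGaussianPair X P) : IsIsonormal hX.isonormal := by
  intro x
  rw [eq_pairIncl_add _ x]
  generalize x 0 = g
  generalize x 1 = h
  induction g, h using UniformSpace.Completion.induction_on₂ with
  | hp =>
    have hc : Continuous fun p : HilbertOf (hX.covFun 0) × HilbertOf (hX.covFun 1) =>
        pairIncl hX.covFun 0 p.1 + pairIncl hX.covFun 1 p.2 := by fun_prop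
    refine isClosed_eq (continuous_integral_exp.comp (hX.isonormal.continuous.comp hc)) ?_
    exact (by fun_prop : Continuous fun y : PairSpace hX.covFun =>
      Complex.exp (-(‖y‖ ^ 2 : ℝ) / 2)).comp hc
  | ih φ ψ =>
    rw [isonormal_pairIncl_add, norm_pairIncl_add_sq, wiener_coe, wiener_coe,
      UniformSpace.Completion.norm_coe, UniformSpace.Completion.norm_coe]
    obtain ⟨s, c, hs⟩ := hX.exists_stepWiener_ae_eq 0 φ
    obtain ⟨s', c', hs'⟩ := hX.exists_stepWiener_ae_eq 1 ψ
    have hind : IndepFun (hX.stepWiener 0 φ) (hX.stepWiener 1 ψ) P := by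
      have := hX.indep.comp (φ := fun x : I → ℝ => ∑ t ∈ s, c t * x t)
        (ψ := fun x : I → ℝ => ∑ t ∈ s', c' t * x t) (by fun_prop) (by fun_prop)
      exact this.congr hs.symm hs'.symm
    have h1 := congrFun (hind.charFun_map_add_eq_mul (aemeasurable_Lp _) (aemeasurable_Lp _)) 1
    rw [Pi.mul_apply, charFun_map_stepWiener, charFun_map_stepWiener, ← Complex.exp_add,
      charFun_apply_real, integral_map
        ((aemeasurable_Lp _).add (aemeasurable_Lp _)) (by fun_prop)] at h1
    have h2 : -((‖φ‖ ^ 2 + ‖ψ‖ ^ 2 : ℝ) : ℂ) / 2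
        = -((‖φ‖ ^ 2 : ℝ) : ℂ) / 2 + -((‖ψ‖ ^ 2 : ℝ) : ℂ) / 2 := by
      push_cast; ring
    rw [h2, ← h1]
    refine integral_congr_ae ?_
    filter_upwards [Lp.coeFn_add (hX.stepWiener 0 φ) (hX.stepWiener 1 ψ)] with ω h3
    rw [h3]
    simp

theorem algDoubleIntegral_tmul (hX : IsGaussianPair X P) (g h : PairSpace hX.covFun) :
    hX.algDoubleIntegral (g ⊗ₜ h) =ᵐ[P]
      fun ω => hX.isonormal g ω * hX.isonormal h ω - inner ℝ g h := by
  have h1 : hX.algDoubleIntegral (g ⊗ₜ h) =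
      (ContinuousLinearMap.mul ℝ ℝ).holder 1 (hX.isonormal g) (hX.isonormal h)
        - (inner ℝ g h) • Lp.const 1 P (1 : ℝ) := rfl
  rw [h1]
  filter_upwards [Lp.coeFn_sub ((ContinuousLinearMap.mul ℝ ℝ).holder 1 (hX.isonormal g)
    (hX.isonormal h)) ((inner ℝ g h) • Lp.const 1 P (1 : ℝ)),
    (ContinuousLinearMap.mul ℝ ℝ).coeFn_holder (r := 1) (hX.isonormal g) (hX.isonormal h),
    Lp.coeFn_smul (inner ℝ g h) (Lp.const 1 P (1 : ℝ)), Lp.coeFn_const 1 P (1 : ℝ)]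
    with ω h2 h3 h4 h5
  rw [h2, Pi.sub_apply, h3, h4, Pi.smul_apply, h5]
  simp

theorem doubleIntegral_coe (hX : IsGaussianPair X P)
    (x : PairSpace hX.covFun ⊗[ℝ] PairSpace hX.covFun) :
    hX.doubleIntegral (x : TensorSq (PairSpace hX.covFun)) = hX.algDoubleIntegral x :=
  LinearMap.extendOfNorm_eq (f := hX.algDoubleIntegral)
    (e := (UniformSpace.Completion.toComplₗᵢ (𝕜 := ℝ)
      (E := PairSpace hX.covFun ⊗[ℝ] PairSpace hX.covFun)).toLinearMap)
    UniformSpace.Completion.denseRange_coe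
    ⟨√chiSqVariance, fun x => by
      refine (norm_doubleIntegral_le hX.algDoubleIntegral_tmul hX.isIsonormal x).trans_eq ?_
      congr 1
      exact (UniformSpace.Completion.norm_coe x).symm⟩ x

end IsGaussianPair

/-! ### Riemann–Stieltjes integrals -/

theorem exists_taggedPartition_meshLT {δ : ℝ} (hδ : 0 < δ) :
    ∃ D : TaggedPartition, D.MeshLT δ := by
  obtain ⟨N, hN⟩ := exists_nat_one_div_lt hδ
  have hpos : (0 : ℝ) < (N : ℝ) + 1 := by positivity
  let pt : ℕ → I := fun k => Set.projIcc 0 1 zero_le_one ((k : ℝ) / (N + 1))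
  have hmono : Monotone pt := fun k l hkl => Set.monotone_projIcc _ (by gcongr)
  refine ⟨⟨N + 1, pt, pt, hmono, ?_, ?_, fun k => ⟨le_rfl, hmono k.le_succ⟩⟩, fun k hk => ?_⟩
  · exact Set.projIcc_of_le_left _ (by simp)
  · refine Set.projIcc_of_right_le _ ?_
    push_cast
    rw [div_self hpos.ne']
  · have hk' : (k : ℝ) + 1 ≤ N + 1 := by exact_mod_cast hk
    have h1 : (pt k : ℝ) = k / (N + 1) := by
      change (Set.projIcc (0 : ℝ) 1 zero_le_one _ : ℝ) = _
      rw [Set.projIcc_of_mem zero_le_one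
        ⟨by positivity, (div_le_one hpos).2 (by linarith)⟩]
    have h2 : (pt (k + 1) : ℝ) = (k + 1) / (N + 1) := by
      change (Set.projIcc (0 : ℝ) 1 zero_le_one (((k + 1 : ℕ) : ℝ) / _) : ℝ) = _
      rw [Set.projIcc_of_mem zero_le_one
        ⟨by positivity, (div_le_one hpos).2 (by push_cast; linarith)⟩]
      push_cast
      rfl
    change (pt (k + 1) : ℝ) - pt k < δ
    rw [h1, h2, ← sub_div, add_sub_cancel_left]
    exact hN

theorem HasStieltjesIntegral.unique {G R : I → I → ℝ} {L L' : ℝ}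
    (h : HasStieltjesIntegral G R L) (h' : HasStieltjesIntegral G R L') : L = L' := by
  refine eq_of_forall_dist_le fun ε hε => ?_
  rw [Real.dist_eq]
  obtain ⟨δ, hδ, H⟩ := h (ε / 2) (by positivity)
  obtain ⟨δ', hδ', H'⟩ := h' (ε / 2) (by positivity)
  obtain ⟨D, hD⟩ := exists_taggedPartition_meshLT (lt_min hδ hδ')
  have h1 := H D D (fun k hk => (hD k hk).trans_le (min_le_left _ _))
    (fun k hk => (hD k hk).trans_le (min_le_left _ _))
  have h2 := H' D D (fun k hk => (hD k hk).trans_le (min_le_right _ _))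
    (fun k hk => (hD k hk).trans_le (min_le_right _ _))
  rw [abs_lt] at h1 h2
  rw [abs_le]
  constructor <;> linarith

theorem HasStieltjesIntegral.neg {G R : I → I → ℝ} {L : ℝ} (h : HasStieltjesIntegral G R L) :
    HasStieltjesIntegral (fun s t => -G s t) R (-L) := by
  intro ε hε
  obtain ⟨δ, hδ, H⟩ := h ε hε
  refine ⟨δ, hδ, fun D D' hD hD' => ?_⟩
  have h1 : riemannSum (fun s t => -G s t) R D D' = -riemannSum G R D D' := by
    simp [riemannSum]
  rw [h1, ← abs_neg, neg_sub_neg, neg_sub, ← abs_neg, neg_sub]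
  rw [abs_sub_comm]
  exact H D D' hD hD'

theorem hasStieltjesIntegral_zero (R : I → I → ℝ) :
    HasStieltjesIntegral (fun _ _ => 0) R 0 := fun ε hε =>
  ⟨1, one_pos, fun D D' _ _ => by simpa [riemannSum] using hε⟩

/-- A Stieltjes integral only depends on the increments of the integrator. -/
theorem HasStieltjesIntegral.congr {G R R' : I → I → ℝ} {L : ℝ}
    (hR : rectIncrement R = rectIncrement R') (h : HasStieltjesIntegral G R L) :
    HasStieltjesIntegral G R' L := by
  simpa only [HasStieltjesIntegral, riemannSum, hR] using h

theorem HasIteratedIntegral.unique {f g R R' : I → I → ℝ} {L L' : ℝ}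
    (h : HasIteratedIntegral f g R R' L) (h' : HasIteratedIntegral f g R R' L') : L = L' := by
  obtain ⟨Φ, h1, h2⟩ := h
  obtain ⟨Φ', h1', h2'⟩ := h'
  have : Φ = Φ' := funext fun u => funext fun v => (h1 u v).unique (h1' u v)
  subst this
  exact h2.unique h2'

theorem HasIteratedIntegral.neg {f g R R' : I → I → ℝ} {L : ℝ}
    (h : HasIteratedIntegral f g R R' L) :
    HasIteratedIntegral (fun s t => -f s t) g R R' (-L) := by
  obtain ⟨Φ, h1, h2⟩ := h
  refine ⟨fun u v => -Φ u v, fun u v => ?_, h2.neg⟩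
  simpa only [neg_mul] using (h1 u v).neg

theorem hasIteratedIntegral_zero (g R R' : I → I → ℝ) :
    HasIteratedIntegral (fun _ _ => 0) g R R' 0 :=
  ⟨fun _ _ => 0, fun u v => by simpa using hasStieltjesIntegral_zero R,
    hasStieltjesIntegral_zero R'⟩

theorem HasIteratedIntegral.congr {f g R R' S S' : I → I → ℝ} {L : ℝ}
    (hR : rectIncrement R = rectIncrement S) (hR' : rectIncrement R' = rectIncrement S')
    (h : HasIteratedIntegral f g R R' L) : HasIteratedIntegral f g S S' L := by
  obtain ⟨Φ, h1, h2⟩ := h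
  exact ⟨Φ, fun u v => (h1 u v).congr hR, h2.congr hR'⟩

/-! ### The block structure of a Lévy element -/

section LevyElement

variable {R : Fin 2 → CovarianceFunction}

theorem stepForm_indIoc_zero (R : I → I → ℝ) (s t : I) :
    stepForm R ⟨indIoc 0 s, indIoc_mem 0 s s.2.1⟩ ⟨indIoc 0 t, indIoc_mem 0 t t.2.1⟩ =
      R s t - R s 0 - R 0 t + R 0 0 := by
  rw [stepForm, stepIntegral_indIoc_zero, LinearMap.sub_apply, stepIntegral_indIoc_zero,
    stepIntegral_indIoc_zero]
  ring

/-- Equivalent covariance functions have the same increments. -/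
theorem Equivalent.rectIncrement_eq {R₁ R₂ : CovarianceFunction} (h : Equivalent R₁ R₂) :
    rectIncrement R₁.toFun = rectIncrement R₂.toFun := by
  obtain ⟨U, hU⟩ := h
  have key : ∀ s t, R₁.toFun s t - R₁.toFun s 0 - R₁.toFun 0 t + R₁.toFun 0 0 =
      R₂.toFun s t - R₂.toFun s 0 - R₂.toFun 0 t + R₂.toFun 0 0 := fun s t => by
    rw [← stepForm_indIoc_zero, ← stepForm_indIoc_zero, ← inner_ofStep, ← inner_ofStep, ← hU,
      ← hU, U.inner_map_map]
  funext a b c d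
  simp only [rectIncrement]
  linear_combination key b d - key b c - key a d + key a c

theorem IsLevyElement.inner_diag {f : TensorSq (PairSpace R)} (hf : IsLevyElement R f) (i : Fin 2)
    (φ ψ : stepFunctions) : inner ℝ f (tens (pairStep R i φ) (pairStep R i ψ)) = 0 := by
  have h : levyKernel i i = fun _ _ => 0 := by
    funext s t
    simp [levyKernel]
  have h1 := hf.2 i i φ ψ
  rw [h] at h1
  exact h1.unique (hasIteratedIntegral_zero _ _ _)

/-- For equivalent covariance functions the two off-diagonal blocks are opposite to each other. -/
theorem IsLevyElement.inner_offDiag {f : TensorSq (PairSpace R)} (hf : IsLevyElement R f)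
    (hR : Equivalent (R 0) (R 1)) (φ ψ : stepFunctions) :
    inner ℝ f (tens (pairStep R 1 φ) (pairStep R 0 ψ)) =
      -inner ℝ f (tens (pairStep R 0 φ) (pairStep R 1 ψ)) := by
  have h : levyKernel 1 0 = fun s t => -levyKernel 0 1 s t := by
    funext s t
    simp [levyKernel]
  have h1 := hf.2 1 0 φ ψ
  rw [h] at h1
  exact h1.unique ((hf.2 0 1 φ ψ).neg.congr hR.rectIncrement_eq hR.rectIncrement_eq.symm)

/-- Induction principle on `H = H₁ ⊕ H₂`, from step functions. -/
theorem pairSpace_induction {p : PairSpace R → Prop} (x : PairSpace R)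
    (hcl : IsClosed {x | p x}) (hadd : ∀ x y, p x → p y → p (x + y))
    (hstep : ∀ i φ, p (pairStep R i φ)) : p x := by
  have h : ∀ i h, p (pairIncl R i h) := fun i h => by
    induction h using UniformSpace.Completion.induction_on with
    | hp => exact hcl.preimage (pairIncl R i).continuous
    | ih φ => exact hstep i ((toStepSpace (R i)).symm φ)
  rw [eq_pairIncl_add R x]
  exact hadd _ _ (h _ _) (h _ _)

/-- Bounded operators on `H` are determined by their matrix coefficients at step functions. -/
theorem clm_ext_pairStep {A B : PairSpace R →L[ℝ] PairSpace R}
    (h : ∀ i φ j ψ, inner ℝ (A (pairStep R i φ)) (pairStep R j ψ) =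
      inner ℝ (B (pairStep R i φ)) (pairStep R j ψ)) : A = B := by
  refine ContinuousLinearMap.ext fun x => ?_
  induction x using pairSpace_induction with
  | hcl => exact isClosed_eq (by fun_prop) (by fun_prop)
  | hadd x y hx hy => rw [map_add, map_add, hx, hy]
  | hstep i φ =>
    refine ext_inner_right ℝ fun y => ?_
    induction y using pairSpace_induction with
    | hcl => exact isClosed_eq (by fun_prop) (by fun_prop)
    | hadd x y hx hy => rw [inner_add_right, inner_add_right, hx, hy]
    | hstep j ψ => exact h i φ j ψ

variable (R) in
/-- The reflection `(g, h) ↦ (g, -h)` of `H₁ ⊕ H₂`. -/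
def pairReflection : PairSpace R ≃ₗᵢ[ℝ] PairSpace R :=
  LinearIsometryEquiv.piLpCongrRight 2 fun i =>
    if i = 0 then LinearIsometryEquiv.refl ℝ _ else LinearIsometryEquiv.neg ℝ

theorem pairReflection_pairStep_zero (φ : stepFunctions) :
    pairReflection R (pairStep R 0 φ) = pairStep R 0 φ := by
  ext i
  fin_cases i <;> simp [pairReflection, pairStep]

theorem pairReflection_pairStep_one (φ : stepFunctions) :
    pairReflection R (pairStep R 1 φ) = -pairStep R 1 φ := by
  ext i
  fin_cases i <;> simp [pairReflection, pairStep]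

/-- The rotation `(g, h) ↦ (-U⁻¹ h, U g)` of `H₁ ⊕ H₂`, for a unitary `U : H₁ → H₂`. -/
def pairRotation (U : HilbertOf (R 0) ≃ₗᵢ[ℝ] HilbertOf (R 1)) : PairSpace R →L[ℝ] PairSpace R :=
  ((pairIncl R 1).comp U.toContinuousLinearEquiv.toContinuousLinearMap).comp (PiLp.proj 2 _ 0) -
    ((pairIncl R 0).comp U.symm.toContinuousLinearEquiv.toContinuousLinearMap).comp
      (PiLp.proj 2 _ 1)

variable {U : HilbertOf (R 0) ≃ₗᵢ[ℝ] HilbertOf (R 1)}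

theorem pairRotation_apply (x : PairSpace R) :
    pairRotation U x = pairIncl R 1 (U (x 0)) - pairIncl R 0 (U.symm (x 1)) := rfl

theorem pairRotation_pairRotation (x : PairSpace R) : pairRotation U (pairRotation U x) = -x := by
  ext i
  fin_cases i <;> simp [pairRotation_apply, pairIncl_apply]

theorem pairRotation_pairStep_zero (hU : ∀ φ, U (ofStep (R 0) φ) = ofStep (R 1) φ)
    (φ : stepFunctions) : pairRotation U (pairStep R 0 φ) = pairStep R 1 φ := by
  rw [pairRotation_apply, ← pairIncl_ofStep R 1, ← hU φ]
  simp [pairStep]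

theorem pairRotation_pairStep_one (hU : ∀ φ, U (ofStep (R 0) φ) = ofStep (R 1) φ)
    (φ : stepFunctions) : pairRotation U (pairStep R 1 φ) = -pairStep R 0 φ := by
  rw [← pairRotation_pairStep_zero hU, pairRotation_pairRotation]

theorem inner_pairRotation (x y : PairSpace R) :
    inner ℝ (pairRotation U x) y = -inner ℝ x (pairRotation U y) := by
  rw [pairRotation_apply, pairRotation_apply, inner_sub_left, inner_sub_right,
    real_inner_comm _ x, real_inner_comm _ x, inner_pairIncl, inner_pairIncl, inner_pairIncl,
    inner_pairIncl, real_inner_comm _ (U (y 0)), real_inner_comm _ (U.symm (y 1)),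
    ← U.inner_map_map (x 0) (U.symm (y 1)), ← U.inner_map_map (U.symm (x 1)),
    U.apply_symm_apply, U.apply_symm_apply]
  ring

theorem inner_pairReflection_pairStep (x : PairSpace R) (j : Fin 2) (ψ : stepFunctions) :
    inner ℝ (pairReflection R x) (pairStep R j ψ) =
      inner ℝ x (pairReflection R (pairStep R j ψ)) := by
  rw [← (pairReflection R).inner_map_map x]
  congr 1
  match j with
  | 0 => simp only [pairReflection_pairStep_zero]
  | 1 => simp only [pairReflection_pairStep_one, map_neg, neg_neg]

/-- The operator of a Lévy element anticommutes with the reflection, since its diagonal blocks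
vanish. -/
theorem IsLevyElement.operator_pairReflection {f : TensorSq (PairSpace R)}
    (hf : IsLevyElement R f) (x : PairSpace R) :
    tensorOperator f (pairReflection R x) = -pairReflection R (tensorOperator f x) := by
  have h : (tensorOperator f).comp (pairReflection R).toContinuousLinearEquiv.toContinuousLinearMap
      = -(pairReflection R).toContinuousLinearEquiv.toContinuousLinearMap.comp
        (tensorOperator f) := by
    refine clm_ext_pairStep fun i φ j ψ => ?_
    change inner ℝ (tensorOperator f (pairReflection R (pairStep R i φ))) (pairStep R j ψ) =
      inner ℝ (-pairReflection R (tensorOperator f (pairStep R i φ))) (pairStep R j ψ)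
    rw [inner_neg_left, inner_pairReflection_pairStep]
    match i, j with
    | 0, 0 => simp [pairReflection_pairStep_zero, inner_tensorOperator, hf.inner_diag]
    | 0, 1 => simp [pairReflection_pairStep_zero, pairReflection_pairStep_one]
    | 1, 0 => simp [pairReflection_pairStep_zero, pairReflection_pairStep_one]
    | 1, 1 => simp [pairReflection_pairStep_one, inner_tensorOperator, hf.inner_diag]
  exact DFunLike.congr_fun h x

/-- The operator of a Lévy element commutes with the rotation, since its off-diagonal blocks are
opposite to each other. -/
theorem IsLevyElement.operator_pairRotation {f : TensorSq (PairSpace R)}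
    (hf : IsLevyElement R f) (hU : ∀ φ, U (ofStep (R 0) φ) = ofStep (R 1) φ) (x : PairSpace R) :
    tensorOperator f (pairRotation U x) = pairRotation U (tensorOperator f x) := by
  have hR : Equivalent (R 0) (R 1) := ⟨U, hU⟩
  have h : (tensorOperator f).comp (pairRotation U) = (pairRotation U).comp (tensorOperator f) := by
    refine clm_ext_pairStep fun i φ j ψ => ?_
    change inner ℝ (tensorOperator f (pairRotation U (pairStep R i φ))) (pairStep R j ψ) =
      inner ℝ (pairRotation U (tensorOperator f (pairStep R i φ))) (pairStep R j ψ)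
    rw [inner_pairRotation]
    match i, j with
    | 0, 0 => simp [pairRotation_pairStep_zero hU, inner_tensorOperator, hf.inner_offDiag hR]
    | 0, 1 => simp [pairRotation_pairStep_zero hU, pairRotation_pairStep_one hU,
        inner_tensorOperator, hf.inner_diag]
    | 1, 0 => simp [pairRotation_pairStep_zero hU, pairRotation_pairStep_one hU,
        inner_tensorOperator, hf.inner_diag]
    | 1, 1 => simp [pairRotation_pairStep_one hU, inner_tensorOperator, hf.inner_offDiag hR]
  exact DFunLike.congr_fun h x

end LevyElement

/-! ### Eigenvectors in opposite pairs -/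

section EigenFamily

variable {H : Type} [NormedAddCommGroup H] [InnerProductSpace ℝ H] [CompleteSpace H]

/-- Indices of an orthonormal family of eigenvectors for the nonzero eigenvalues of `F`: a positive
eigenvalue `α`, an index in a basis of its eigenspace, and a sign (`true` for `-α`). -/
abbrev EigenIndex (F : H →L[ℝ] H) : Type :=
  Σ α : PosEigenvalues F,
    Fin (Module.finrank ℝ (Module.End.eigenspace F.toLinearMap (α : ℝ))) × Bool

/-- The eigenvalue at an index. -/
def eigenIndexValue {F : H →L[ℝ] H} (p : EigenIndex F) : ℝ := bif p.2.2 then -p.1 else p.1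

variable {F : H →L[ℝ] H}

theorem finiteDimensional_eigenspace (hF : IsCompactOperator F) (α : PosEigenvalues F) :
    FiniteDimensional ℝ (Module.End.eigenspace F.toLinearMap (α : ℝ)) :=
  ContinuousLinearMap.finite_dimensional_eigenspace hF _ α.2.1.ne'

/-- Orthonormal bases of the eigenspaces of the positive eigenvalues, and their images under a
reflection `S` which exchanges opposite eigenspaces. -/
def eigenFamily (hF : IsCompactOperator F) (S : H ≃ₗᵢ[ℝ] H) (p : EigenIndex F) : H :=
  have := finiteDimensional_eigenspace hF p.1
  let v : H := stdOrthonormalBasis ℝ (Module.End.eigenspace F.toLinearMap (p.1 : ℝ)) p.2.1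
  bif p.2.2 then S v else v

variable (hF : IsCompactOperator F) {S : H ≃ₗᵢ[ℝ] H}

theorem apply_eigenFamily (hSF : ∀ x, F (S x) = -S (F x)) (p : EigenIndex F) :
    F (eigenFamily hF S p) = eigenIndexValue p • eigenFamily hF S p := by
  obtain ⟨α, k, s⟩ := p
  have := finiteDimensional_eigenspace hF α
  set v := stdOrthonormalBasis ℝ (Module.End.eigenspace F.toLinearMap (α : ℝ)) k
  have hv : F v = (α : ℝ) • (v : H) := Module.End.mem_eigenspace_iff.1 v.2
  cases s
  · exact hv
  · change F (S v) = (-α : ℝ) • S v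
    rw [hSF, hv, map_smul, neg_smul]

theorem orthonormal_eigenFamily (hsymm : F.toLinearMap.IsSymmetric)
    (hSF : ∀ x, F (S x) = -S (F x)) : Orthonormal ℝ (eigenFamily hF S) := by
  refine ⟨fun p => ?_, fun p q hpq => ?_⟩
  · obtain ⟨α, k, s⟩ := p
    have := finiteDimensional_eigenspace hF α
    have h1 : ‖(stdOrthonormalBasis ℝ (Module.End.eigenspace F.toLinearMap (α : ℝ)) k : H)‖ = 1 :=
      (stdOrthonormalBasis ℝ _).orthonormal.1 k
    cases s
    · exact h1
    · exact (S.norm_map _).trans h1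
  · by_cases hc : eigenIndexValue p = eigenIndexValue q
    · obtain ⟨α, k, s⟩ := p
      obtain ⟨β, l, s'⟩ := q
      have hα := α.2.1
      have hβ := β.2.1
      obtain ⟨rfl, rfl⟩ : α = β ∧ s = s' := by
        rw [Subtype.ext_iff]
        cases s <;> cases s' <;> simp [eigenIndexValue] at hc ⊢
        · exact hc
        · linarith
        · linarith
        · exact hc
      have := finiteDimensional_eigenspace hF α
      have hkl : k ≠ l := fun h => hpq (by rw [h])
      have h1 : inner ℝ
          (stdOrthonormalBasis ℝ (Module.End.eigenspace F.toLinearMap (α : ℝ)) k : H)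
          (stdOrthonormalBasis ℝ (Module.End.eigenspace F.toLinearMap (α : ℝ)) l : H) = 0 :=
        (stdOrthonormalBasis ℝ _).orthonormal.2 hkl
      cases s
      · exact h1
      · exact (S.inner_map_map _ _).trans h1
    · have h1 : inner ℝ (F (eigenFamily hF S p)) (eigenFamily hF S q) =
          inner ℝ (eigenFamily hF S p) (F (eigenFamily hF S q)) := hsymm _ _
      rw [apply_eigenFamily hF hSF, apply_eigenFamily hF hSF, inner_smul_left,
        inner_smul_right] at h1
      exact (mul_eq_mul_right_iff.1 h1).resolve_left hc

/-- By the spectral theorem, the eigenfamily spans the orthogonal complement of the kernel. -/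
theorem apply_eq_zero_of_orthogonal_eigenFamily (hsymm : F.toLinearMap.IsSymmetric)
    (hSF : ∀ x, F (S x) = -S (F x)) {x : H} (hx : ∀ p, inner ℝ (eigenFamily hF S p) x = 0) :
    F x = 0 := by
  -- With `T` the identity or the reflection this covers both halves of the family.
  have hpos : ∀ (α : ℝ) (hα : 0 < α), ∀ (T : H →ₗ[ℝ] H),
      (∀ (h : Module.End.HasEigenvalue F.toLinearMap α) k,
      inner ℝ (T (@stdOrthonormalBasis ℝ _ (Module.End.eigenspace F.toLinearMap α) _ _
        (finiteDimensional_eigenspace hF ⟨α, hα, h⟩) k : H)) x = 0) →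
      ∀ y ∈ Module.End.eigenspace F.toLinearMap α, inner ℝ (T y) x = 0 := by
    intro α hα T hT y hy
    by_cases h : Module.End.HasEigenvalue F.toLinearMap α
    · have := finiteDimensional_eigenspace hF ⟨α, hα, h⟩
      have h1 := (stdOrthonormalBasis ℝ (Module.End.eigenspace F.toLinearMap α)).sum_repr ⟨y, hy⟩
      have h2 := congrArg (Submodule.subtype _) h1
      simp only [map_sum, map_smul, Submodule.subtype_apply] at h2
      rw [← h2]
      simp only [map_sum, map_smul, sum_inner, inner_smul_left]
      exact Finset.sum_eq_zero fun k _ => by rw [hT h k, mul_zero]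
    · rw [Module.End.hasEigenvalue_iff, not_not] at h
      rw [h, Submodule.mem_bot] at hy
      rw [hy, map_zero, inner_zero_left]
  have horth : ∀ α ≠ 0, ∀ y ∈ Module.End.eigenspace F.toLinearMap α, inner ℝ y x = 0 := by
    intro α hα y hy
    rcases hα.lt_or_gt with h | h
    · have hSy := map_mem_eigenspace_neg S.symm.toContinuousLinearEquiv
        (symm_anticomm S.toContinuousLinearEquiv hSF) hy
      have := hpos (-α) (by linarith) S.toLinearEquiv.toLinearMap
        (fun h k => hx ⟨⟨-α, by linarith, h⟩, k, true⟩) _ hSy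
      simpa using this
    · exact hpos α h LinearMap.id (fun h' k => hx ⟨⟨α, h, h'⟩, k, false⟩) y hy
  have hmem : F x ∈ (⨆ μ, Module.End.eigenspace (F : Module.End ℝ H) μ)ᗮ := by
    rw [Submodule.mem_orthogonal]
    intro y hy
    induction hy using Submodule.iSup_induction' with
    | mem μ y hy =>
      have hFy : F y = μ • y := Module.End.mem_eigenspace_iff.1 hy
      have h1 : inner ℝ y (F x) = inner ℝ (F y) x := (hsymm y x).symm
      rw [h1, hFy, inner_smul_left]
      by_cases hμ : μ = 0
      · simp [hμ]
      · rw [horth μ hμ y hy, mul_zero]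
    | zero => exact inner_zero_left _
    | add y z _ _ hy hz => rw [inner_add_left, hy, hz, add_zero]
  rw [ContinuousLinearMap.orthogonalComplement_iSup_eigenspaces_eq_bot hF hsymm] at hmem
  exact (Submodule.mem_bot ℝ).1 hmem

end EigenFamily

/-! ### The characteristic function -/

section CharFun

variable {Ω : Type*} [MeasurableSpace Ω] {P : Measure Ω} [IsProbabilityMeasure P]
variable {H : Type} [NormedAddCommGroup H] [InnerProductSpace ℝ H] [CompleteSpace H]

omit [CompleteSpace H] in
theorem prod_chiSqCharFun_eigenIndexValue {F : H →L[ℝ] H} (α : PosEigenvalues F) {m : ℕ}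
    (hm : Module.finrank ℝ (Module.End.eigenspace F.toLinearMap (α : ℝ)) = 2 * m) (t : ℝ) :
    ∏ k, chiSqCharFun (eigenIndexValue (⟨α, k⟩ : EigenIndex F) * t) =
      ((((1 + 4 * (α : ℝ) ^ 2 * t ^ 2) ^ m)⁻¹ : ℝ) : ℂ) := by
  rw [Fintype.prod_prod_type]
  simp only [eigenIndexValue, Fintype.prod_bool, cond_true, cond_false, Finset.prod_const,
    Finset.card_univ, Fintype.card_fin]
  rw [hm, pow_mul, neg_mul, mul_comm (chiSqCharFun (-_)), chiSqCharFun_mul_neg_sq,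
    ← Complex.ofReal_pow, inv_pow, mul_pow, mul_assoc]

/-- Partial sums of the spectral expansion of `f` over finite sets of positive eigenvalues turn
into partial products of characteristic functions. -/
theorem hasProd_charFun_doubleIntegral {W : H →L[ℝ] Lp ℝ 2 P} (hW : IsIsonormal W)
    {D : H ⊗[ℝ] H →ₗ[ℝ] Lp ℝ 1 P}
    (hD : ∀ g h : H, D (g ⊗ₜ h) =ᵐ[P] fun ω => W g ω * W h ω - inner ℝ g h)
    {T : TensorSq H →L[ℝ] Lp ℝ 1 P} (hT : ∀ x : H ⊗[ℝ] H, T x = D x)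
    {f : TensorSq H} (hf : f ∈ symTensorSq H) {S : H ≃ₗᵢ[ℝ] H}
    (hS : ∀ x, tensorOperator f (S x) = -S (tensorOperator f x))
    {m : PosEigenvalues (tensorOperator f) → ℕ}
    (hm : ∀ α : PosEigenvalues (tensorOperator f), Module.finrank ℝ
      (Module.End.eigenspace (tensorOperator f).toLinearMap (α : ℝ)) = 2 * m α) (t : ℝ) :
    HasProd (fun α : PosEigenvalues (tensorOperator f) =>
        ((((1 + 4 * (α : ℝ) ^ 2 * t ^ 2) ^ m α)⁻¹ : ℝ) : ℂ))
      (∫ ω, Complex.exp (Complex.I * t * T f ω) ∂P) := by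
  have hF := isCompactOperator_tensorOperator f
  have hsymm := tensorOperator_isSymmetric hf
  have he := orthonormal_eigenFamily hF hsymm hS
  have hsum := hasSum_tens_of_eigenvectors he (apply_eigenFamily hF hS)
    fun x hx => apply_eq_zero_of_orthogonal_eigenFamily hF hsymm hS hx
  -- Grouping by positive eigenvalues gives summation along the finite sets of the product.
  have hsum' := hsum.sigma fun α => hasSum_fintype _
  have hcont : Continuous fun g : TensorSq H =>
      ∫ ω, Complex.exp ((t • T g : Lp ℝ 1 P) ω * Complex.I) ∂P :=
    continuous_integral_exp.comp (by fun_prop)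
  have hlim := (hcont.tendsto f).comp hsum'
  have hval : ∫ ω, Complex.exp ((t • T f : Lp ℝ 1 P) ω * Complex.I) ∂P =
      ∫ ω, Complex.exp (Complex.I * t * T f ω) ∂P := by
    refine integral_congr_ae ?_
    filter_upwards [Lp.coeFn_smul t (T f)] with ω hω
    rw [hω, Pi.smul_apply, smul_eq_mul]
    push_cast
    ring_nf
  rw [hval] at hlim
  refine hlim.congr fun s => ?_
  rw [Function.comp_apply, Finset.sum_sigma', integral_exp_doubleIntegral_sum hD hW hT _ he,
    Finset.prod_sigma]
  exact Finset.prod_congr rfl fun α _ => prod_chiSqCharFun_eigenIndexValue α (hm α) t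

end CharFun

end LevyArea

end

theorem mainTheorem2 {Ω : Type*} [MeasurableSpace Ω] {P : MeasureTheory.Measure Ω}
    [MeasureTheory.IsProbabilityMeasure P] {X : Fin 2 → unitInterval → Ω → ℝ}
    (hX : LevyArea.IsGaussianPair X P)
    (hequiv : LevyArea.Equivalent (hX.covFun 0) (hX.covFun 1))
    (f : LevyArea.TensorSq (LevyArea.PairSpace hX.covFun))
    (hf : LevyArea.IsLevyElement hX.covFun f)
    (F : LevyArea.PairSpace hX.covFun →L[ℝ] LevyArea.PairSpace hX.covFun)
    (hF : F = LevyArea.tensorOperator f) :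
    LevyArea.IsHilbertSchmidt F ∧
    (∀ α : ℝ, α ∈ spectrum ℝ F ↔ -α ∈ spectrum ℝ F) ∧
    (∀ α : ℝ, Module.rank ℝ (Module.End.eigenspace F.toLinearMap (-α)) =
      Module.rank ℝ (Module.End.eigenspace F.toLinearMap α)) ∧
    (∀ α : ℝ, Even (Module.rank ℝ (Module.End.eigenspace F.toLinearMap α))) ∧
    (∀ α : ℝ, α ≠ 0 → FiniteDimensional ℝ (Module.End.eigenspace F.toLinearMap α)) ∧
    ∃ m : LevyArea.PosEigenvalues F → ℕ,
      (∀ α, 1 ≤ m α) ∧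
      (∀ α : LevyArea.PosEigenvalues F,
        Module.finrank ℝ (Module.End.eigenspace F.toLinearMap (α : ℝ)) = 2 * m α) ∧
      ∀ t : ℝ, HasProd (fun α : LevyArea.PosEigenvalues F =>
           ((((1 + 4 * (α : ℝ) ^ 2 * t ^ 2) ^ m α)⁻¹ : ℝ) : ℂ))
        (∫ ω, Complex.exp (Complex.I * t * hX.doubleIntegral f ω) ∂P) := by
  subst hF
  obtain ⟨U, hU⟩ := hequiv
  have hS := hf.operator_pairReflection
  have hcpt := LevyArea.isCompactOperator_tensorOperator f
  have hrank := LevyArea.exists_rank_eigenspace_eq_two_mul (F := LevyArea.tensorOperator f)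
    (LevyArea.pairRotation U).toLinearMap LevyArea.pairRotation_pairRotation
    (hf.operator_pairRotation hU)
  have hneg := fun {α : ℝ} => LevyArea.neg_mem_spectrum (F := LevyArea.tensorOperator f)
    (LevyArea.pairReflection hX.covFun).toContinuousLinearEquiv hS (α := α)
  have hfin := fun (α : ℝ) (hα : α ≠ 0) =>
    ContinuousLinearMap.finite_dimensional_eigenspace hcpt α hα
  refine ⟨LevyArea.isHilbertSchmidt_tensorOperator f,
    fun α => ⟨hneg, fun h => by simpa using hneg h⟩,
    LevyArea.rank_eigenspace_neg (LevyArea.pairReflection hX.covFun).toContinuousLinearEquiv hS,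
    fun α => ?_, hfin, ?_⟩
  · obtain ⟨c, hc⟩ := hrank α
    exact ⟨c, by rw [hc, two_mul]⟩
  · choose c hc using hrank
    have hm : ∀ α : LevyArea.PosEigenvalues (LevyArea.tensorOperator f), Module.finrank ℝ
        (Module.End.eigenspace (LevyArea.tensorOperator f).toLinearMap (α : ℝ)) =
          2 * (c α).toNat := fun α => by
      rw [Module.finrank, hc, Cardinal.toNat_mul]
      simp
    refine ⟨fun α => (c α).toNat, fun α => ?_, hm,
      LevyArea.hasProd_charFun_doubleIntegral hX.isIsonormal hX.algDoubleIntegral_tmul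
        hX.doubleIntegral_coe hf.1 hS hm⟩
    have := hfin α α.2.1.ne'
    have : Nontrivial (Module.End.eigenspace (LevyArea.tensorOperator f).toLinearMap (α : ℝ)) :=
      Submodule.nontrivial_iff_ne_bot.2 (Module.End.hasEigenvalue_iff.1 α.2.2)
    have hpos := Module.finrank_pos (R := ℝ)
      (M := Module.End.eigenspace (LevyArea.tensorOperator f).toLinearMap (α : ℝ))
    rw [hm α] at hpos
    exact Nat.pos_of_mul_pos_left hpos
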